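/- For $s>0$ let $\mathcal H^3_s=\{(y,\sqrt{|y|^2-s^2}) : y\in\mathbb R^3,\ |y|\ge s\}\subset\mathbb R^3\times\mathbb R$ be the upper half of the one-sheeted hyperboloid, equipped with the measure $\mu_s$ given by $$\int F\,d\mu_s=\int_{\{y\in\mathbb R^3:\,|y|>s\}}F\bigl(y,\sqrt{|y|^2-s^2}\bigr)\,\frac{dy}{\sqrt{|y|^2-s^2}},$$ write $L^2(\mathcal H^3_s)=L^2(\mu_s)$ (complex-valued functions), and let $T_s$ be the associated Fourier extension operator $$T_sf(x,t)=\int e^{i(x\cdot y+t\tau)}f(y,\tau)\,d\mu_s(y,\tau),\qquad (x,t)\in\mathbb R^3\times\mathbb R.$$ There exists a constant $C<\infty$ with the following property. Let $s>0$, let $k,k'\in\mathbb N=\{0,1,2,\dots\}$, and let $f,g\in L^2(\mathcal H^3_s)$ be supported where $2^{k}s\le|y|\le 2^{k+1}s$ and $2^{k'}s\le|y|\le 2^{k'+1}s$, respectively. Then $f,g\in L^1(\mu_s)$, so that the integrals defining $T_sf$ and $T_sg$ converge absolutely, the product $T_sf\cdot T_sg$ belongs to $L^2(\mathbb R^4)$,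 and $$\|T_sf\cdot T_sg\|_{L^2(\mathbb R^4)}\le C\,2^{-\frac14|k-k'|}\,\|f\|_{L^2(\mathcal H^3_s)}\,\|g\|_{L^2(\mathcal H^3_s)}.$$ -/

import Mathlib

open MeasureTheory

/-- The frequency and physical space `ℝ³ × ℝ`, with its Lebesgue (product) measure as `volume`. -/
abbrev SpaceTime : Type := EuclideanSpace ℝ (Fin 3) × ℝ

/-- The graph map `y ↦ (y, √(|y|² - s²))`, whose image of `{|y| ≥ s}` is the upper half of the
one-sheeted hyperboloid of parameter `s`. -/
noncomputable def hypLift (s : ℝ) (y : EuclideanSpace ℝ (Fin 3)) : SpaceTime :=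
  (y, Real.sqrt (‖y‖ ^ 2 - s ^ 2))

/-- The measure `μ_s` on the upper half `ℋ³_s` of the one-sheeted hyperboloid, as a measure on
`ℝ³ × ℝ` carried by `ℋ³_s`:
`∫ F dμ_s = ∫_{|y| > s} F(y, √(|y|² - s²)) dy / √(|y|² - s²)`. -/
noncomputable def hypMeasure (s : ℝ) : Measure SpaceTime :=
  ((volume.restrict {y : EuclideanSpace ℝ (Fin 3) | s < ‖y‖}).withDensity
    (fun y => ENNReal.ofReal (1 / Real.sqrt (‖y‖ ^ 2 - s ^ 2)))).map (hypLift s)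

/-- The Fourier extension operator
`T_s f (x, t) = ∫ e^{i (x · y + t τ)} f(y, τ) dμ_s(y, τ)`, an absolutely convergent integral for
`f ∈ L¹(μ_s)`, in particular for `f ∈ L²(μ_s)` vanishing outside a bounded region. -/
noncomputable def hypExtension (s : ℝ) (f : SpaceTime → ℂ) (z : SpaceTime) : ℂ :=
  ∫ p, Complex.exp (Complex.I * ((inner ℝ z.1 p.1 + z.2 * p.2 : ℝ) : ℂ)) * f p ∂(hypMeasure s)

/-! By Plancherel the product of two extensions is controlled by a convolution: if `μ_s|A * μ_s|B`
has density at most `D`, Cauchy–Schwarz gives the bilinear bound with constant `(2π)² √D`. Since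
only `|T_s g|` matters, `T_s g` may be replaced by its conjugate, so the reflected convolution,
carried by the differences `a - b`, serves equally well. The sign `e = ±1` records this choice.

The density is computed over a fixed `ξ = a + e b`. In three dimensions `dy` is at most `π / (2|ξ|)`
times the measure in the squared distances `|y|²` and `|ξ - y|²`. In the heights `u`, `v` the
singular weights cancel the Jacobian of `u ↦ u² + s²`, leaving `(2π / |ξ|) du dv`. On the line `u +
e v = τ` the density is thus at most `2π / |ξ|` times the length of the set of admissible `u`.

Three regimes, with `k ≤ k'`: (1) `k' ≥ k + 2`: `|ξ| ≳ 2^{k'} s` while `u ≲ 2^k s`, so `√D ≲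
2^{-(k'-k)/2}`, better than required. (2) `k' ≤ k + 1` and `k' ≥ 1`: `ξ` may be small, but `||y| -
|ξ - y|| ≤ |ξ|` confines `u` to a set of diameter at most `4|ξ|`, because one factor avoids the
equator. (3) `k = k' = 0`: heights may vanish and this monotonicity degenerates. Small cubes are
used instead: over each pair of cubes either all sums or all differences have norm at least `s / 2`,
and there are boundedly many pairs. -/

/-! ### Plancherel for the Fourier integral on `L¹ ∩ L²`. -/

open scoped FourierTransform SchwartzMap in
/-- On `L¹ ∩ L²` the `L²` Fourier transform is given by the Fourier integral. -/
theorem fourier_toLp_ae_eq {E : Type*} [NormedAddCommGroup E] [InnerProductSpace ℝ E]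
    [FiniteDimensional ℝ E] [MeasurableSpace E] [BorelSpace E] {φ : E → ℂ}
    (h1 : Integrable φ) (h2 : MemLp φ 2) :
    ((𝓕 h2.toLp : Lp (α := E) ℂ 2) : E → ℂ) =ᵐ[volume] 𝓕 φ := by
  have hcont : Continuous (𝓕 φ) :=
    VectorFourier.fourierIntegral_continuous Real.continuous_fourierChar
      (by simp only [innerₗ_apply_apply]; fun_prop) h1
  refine ae_eq_of_integral_contDiff_smul_eq ?_ hcont.locallyIntegrable ?_
  · exact (Lp.memLp _).locallyIntegrable (by norm_num)
  intro g hg hgc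
  have hg₁ : HasCompactSupport (Complex.ofRealCLM ∘ g) := hgc.comp_left rfl
  have hg₂ : ContDiff ℝ (⊤ : ℕ∞) (Complex.ofRealCLM ∘ g) := by fun_prop
  set ψ : 𝓢(E, ℂ) := hg₁.toSchwartzMap hg₂ with hψ
  -- The `L²` transform agrees with the distributional one, which acts by moving `𝓕` onto the test
  -- function; for integrable `φ` the multiplication formula moves it back.
  have key := congrArg (fun T => T ψ) (Lp.fourier_toTemperedDistribution_eq (h2.toLp φ))
  simp only [TemperedDistribution.fourier_apply, Lp.toTemperedDistribution_apply] at key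
  have e1 : ∫ x, (𝓕 ψ) x • (h2.toLp φ) x = ∫ x, (𝓕 ψ) x • φ x := by
    refine integral_congr_ae ?_
    filter_upwards [h2.coeFn_toLp] with x hx
    rw [hx]
  have e2 : ∫ x, (𝓕 ψ) x • φ x = ∫ x, ψ x • 𝓕 φ x := by
    rw [SchwartzMap.fourier_coe]
    exact VectorFourier.integral_fourierIntegral_smul_eq_flip (L := innerₗ E)
      Real.continuous_fourierChar
      (by simp only [innerₗ_apply_apply]; fun_prop) ψ.integrable h1 |>.trans (by
        simp only [flip_innerₗ]; rfl)
  have e3 : ∀ F : E → ℂ, ∫ x, g x • F x = ∫ x, ψ x • F x := by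
    intro F
    refine integral_congr_ae (Filter.Eventually.of_forall fun x => ?_)
    simp [hψ]
  rw [e3, e3, ← e2, ← e1]
  exact key.symm

open scoped FourierTransform in
/-- Plancherel's theorem for the Fourier integral on `L¹ ∩ L²`. -/
theorem lintegral_enorm_fourier_sq {E : Type*} [NormedAddCommGroup E] [InnerProductSpace ℝ E]
    [FiniteDimensional ℝ E] [MeasurableSpace E] [BorelSpace E] {φ : E → ℂ}
    (h1 : Integrable φ) (h2 : MemLp φ 2) :
    ∫⁻ q, ‖𝓕 φ q‖ₑ ^ 2 = ∫⁻ x, ‖φ x‖ₑ ^ 2 := by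
  have hn : eLpNorm (𝓕 φ) 2 volume = eLpNorm φ 2 volume := by
    rw [← eLpNorm_congr_ae (fourier_toLp_ae_eq h1 h2)]
    have h := Lp.norm_fourier_eq (h2.toLp φ)
    rw [Lp.norm_def, Lp.norm_def, ENNReal.toReal_eq_toReal_iff' (Lp.eLpNorm_ne_top _)
      (Lp.eLpNorm_ne_top _)] at h
    rw [h, eLpNorm_congr_ae h2.coeFn_toLp]
  have h := congrArg (· ^ (2 : ℝ)) hn
  simp only [eLpNorm_eq_lintegral_rpow_enorm_toReal (two_ne_zero) ENNReal.ofNat_ne_top,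
    ENNReal.toReal_ofNat, ← ENNReal.rpow_mul] at h
  simpa using h

/-! ### Oscillatory transforms on space-time and their normalisation. -/

/-- The integral `∫ e^{i z · p} F(p) dν(p)` over `ℝ³ × ℝ`. -/
noncomputable def oscTransform (ν : Measure SpaceTime) (F : SpaceTime → ℂ) (z : SpaceTime) : ℂ :=
  ∫ p, Complex.exp (Complex.I * ((inner ℝ z.1 p.1 + z.2 * p.2 : ℝ) : ℂ)) * F p ∂ν

open scoped FourierTransform in
theorem oscTransform_volume_smul (φ : SpaceTime → ℂ) (q : SpaceTime) :
    oscTransform volume φ ((-(2 * Real.pi)) • q) =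
      𝓕 (fun w : WithLp 2 SpaceTime => φ (WithLp.ofLp w)) (WithLp.toLp 2 q) := by
  rw [Real.fourier_eq', oscTransform]
  rw [← (WithLp.volume_preserving_ofLp (EuclideanSpace ℝ (Fin 3)) ℝ).integral_comp
    (MeasurableEquiv.toLp 2 SpaceTime).symm.measurableEmbedding]
  refine integral_congr_ae (Filter.Eventually.of_forall fun w => ?_)
  simp only [smul_eq_mul]
  congr 2
  rw [WithLp.prod_inner_apply]
  simp only [Prod.smul_fst, Prod.smul_snd, real_inner_smul_left, smul_eq_mul]
  rw [real_inner_comm]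
  simp
  ring

instance isAddHaarMeasure_volume_spaceTime : (volume : Measure SpaceTime).IsAddHaarMeasure :=
  inferInstanceAs
    (((volume : Measure (EuclideanSpace ℝ (Fin 3))).prod (volume : Measure ℝ)).IsAddHaarMeasure)

/-- Plancherel after the dilation by `-2π` that turns `e^{-2πi}` into `e^{i}`; the Jacobian in
dimension four gives `(2π)^4`. The passage to `WithLp 2` supplies the Euclidean inner product, which
the sup-normed product lacks. -/
theorem lintegral_enorm_oscTransform_volume_sq {φ : SpaceTime → ℂ}
    (h1 : Integrable φ) (h2 : MemLp φ 2) :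
    ∫⁻ q, ‖oscTransform volume φ q‖ₑ ^ 2 =
      ENNReal.ofReal ((2 * Real.pi) ^ 4) * ∫⁻ x, ‖φ x‖ₑ ^ 2 := by
  have hvp := WithLp.volume_preserving_ofLp (EuclideanSpace ℝ (Fin 3)) ℝ
  have hemb := (MeasurableEquiv.toLp 2 SpaceTime).symm.measurableEmbedding
  have hemb' := (MeasurableEquiv.toLp 2 SpaceTime).measurableEmbedding
  have hr : (-(2 * Real.pi)) ≠ 0 := by simp [Real.pi_ne_zero]
  have hP := lintegral_enorm_fourier_sq (E := WithLp 2 SpaceTime)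
    (φ := fun w => φ (WithLp.ofLp w)) (hvp.integrable_comp_of_integrable h1)
    (h2.comp_measurePreserving hvp)
  have hR : ∫⁻ w : WithLp 2 SpaceTime, ‖φ (WithLp.ofLp w)‖ₑ ^ 2 = ∫⁻ x, ‖φ x‖ₑ ^ 2 :=
    hvp.lintegral_comp_emb hemb (fun x => ‖φ x‖ₑ ^ 2)
  have hvp' := WithLp.volume_preserving_toLp (EuclideanSpace ℝ (Fin 3)) ℝ
  rw [hR, ← hvp'.lintegral_comp_emb hemb'] at hP
  simp only [← oscTransform_volume_smul] at hP
  have hmap := Measure.map_addHaar_smul (volume : Measure SpaceTime) hr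
  have hfin : Module.finrank ℝ SpaceTime = 4 := by simp
  rw [hfin] at hmap
  have hS : ∫⁻ q, ‖oscTransform volume φ ((-(2 * Real.pi)) • q)‖ₑ ^ 2 =
      ENNReal.ofReal |((-(2 * Real.pi)) ^ 4)⁻¹| * ∫⁻ q, ‖oscTransform volume φ q‖ₑ ^ 2 := by
    rw [← smul_eq_mul (ENNReal.ofReal _), ← lintegral_smul_measure, ← hmap]
    exact ((Homeomorph.smul (isUnit_iff_ne_zero.2 hr).unit).measurableEmbedding.lintegral_map
      (fun q => ‖oscTransform volume φ q‖ₑ ^ 2)).symm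
  rw [← hP, hS, ← mul_assoc, ← ENNReal.ofReal_mul (by positivity)]
  rw [Even.neg_pow (by decide), abs_of_nonneg (by positivity), mul_inv_cancel₀ (by positivity)]
  simp

theorem norm_cexp_I_mul_ofReal (x : ℝ) : ‖Complex.exp (Complex.I * (x : ℂ))‖ = 1 := by
  rw [mul_comm, Complex.norm_exp_ofReal_mul_I]

theorem continuous_oscTransform {ν : Measure SpaceTime} {F : SpaceTime → ℂ}
    (hF : Integrable F ν) : Continuous (oscTransform ν F) := by
  refine continuous_of_dominated (bound := fun p => ‖F p‖) (fun z => ?_) (fun z => ?_) hF.norm ?_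
  · refine AEStronglyMeasurable.mul (Continuous.aestronglyMeasurable ?_) hF.1
    fun_prop
  · refine Filter.Eventually.of_forall fun p => ?_
    rw [norm_mul, norm_cexp_I_mul_ofReal, one_mul]
  · refine Filter.Eventually.of_forall fun p => ?_
    fun_prop

/-! ### Bilinear `L²` bounds from convolution densities. -/

theorem oscTransform_mul_oscTransform_smul {ν₁ ν₂ : Measure SpaceTime} [SFinite ν₁] [SFinite ν₂]
    (F G : SpaceTime → ℂ) (e : ℝ) (z : SpaceTime) :
    oscTransform ν₁ F z * oscTransform ν₂ G (e • z) =
      ∫ w, Complex.exp (Complex.I *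
        ((inner ℝ z.1 (w.1 + e • w.2).1 + z.2 * (w.1 + e • w.2).2 : ℝ) : ℂ)) *
          (F w.1 * G w.2) ∂(ν₁.prod ν₂) := by
  rw [oscTransform, oscTransform, ← integral_prod_mul]
  refine integral_congr_ae (Filter.Eventually.of_forall fun w => ?_)
  simp only
  rw [mul_mul_mul_comm, ← Complex.exp_add]
  congr 2
  simp only [Prod.fst_add, Prod.snd_add, Prod.smul_fst, Prod.smul_snd, inner_add_right,
    real_inner_smul_left, real_inner_smul_right, smul_eq_mul]
  push_cast
  ring

/-- Duality between the product of two oscillatory transforms and the oscillatory transform of a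
test function. -/
theorem integral_mul_oscTransform_mul {ν₁ ν₂ : Measure SpaceTime} [SFinite ν₁] [SFinite ν₂]
    {F G φ : SpaceTime → ℂ} (e : ℝ) (hF : Integrable F ν₁) (hG : Integrable G ν₂)
    (hφ : Integrable φ) :
    ∫ z, φ z * (oscTransform ν₁ F z * oscTransform ν₂ G (e • z)) =
      ∫ w, (F w.1 * G w.2) * oscTransform volume φ (w.1 + e • w.2) ∂(ν₁.prod ν₂) := by
  simp_rw [oscTransform_mul_oscTransform_smul, ← integral_const_mul]
  rw [integral_integral_swap]
  · refine integral_congr_ae (Filter.Eventually.of_forall fun w => ?_)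
    simp only [oscTransform]
    rw [← integral_const_mul]
    refine integral_congr_ae (Filter.Eventually.of_forall fun z => ?_)
    simp only
    rw [real_inner_comm, mul_comm z.2]
    ring
  · have h := hφ.mul_prod (hF.mul_prod hG)
    have hb := h.bdd_mul (c := 1)
      (f := fun x : SpaceTime × SpaceTime × SpaceTime => Complex.exp (Complex.I *
        ((inner ℝ x.1.1 (x.2.1 + e • x.2.2).1 + x.1.2 * (x.2.1 + e • x.2.2).2 : ℝ) : ℂ)))
      (Continuous.aestronglyMeasurable (by fun_prop))
      (Filter.Eventually.of_forall fun x => (norm_cexp_I_mul_ofReal _).le)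
    refine hb.congr (Filter.Eventually.of_forall fun x => ?_)
    simp only [Function.uncurry]
    ring

theorem le_of_sq_le_mul_self {X K : ENNReal} (hX : X ≠ ⊤) (h : X ^ 2 ≤ K * X) : X ≤ K := by
  rcases eq_or_ne X 0 with rfl | h0
  · simp
  · rw [pow_two] at h
    exact (ENNReal.mul_le_mul_iff_left h0 hX).1 h

theorem lintegral_mul_sq_le {α : Type*} [MeasurableSpace α] {μ : Measure α} {f g : α → ENNReal}
    (hf : AEMeasurable f μ) (hg : AEMeasurable g μ) :
    (∫⁻ a, f a * g a ∂μ) ^ 2 ≤ (∫⁻ a, f a ^ 2 ∂μ) * ∫⁻ a, g a ^ 2 ∂μ := by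
  have h := ENNReal.lintegral_mul_le_Lp_mul_Lq μ Real.HolderConjugate.two_two hf hg
  have h2 := pow_le_pow_left₀ zero_le h 2
  refine h2.trans (le_of_eq ?_)
  rw [mul_pow, ← ENNReal.rpow_natCast, ← ENNReal.rpow_natCast, ← ENNReal.rpow_mul,
    ← ENNReal.rpow_mul]
  simp

/-- If the `e`-twisted convolution of `ν₁` and `ν₂` has density at most `D`, then the product of
the oscillatory transforms is bounded in `L²`. -/
theorem lintegral_enorm_oscTransform_mul_smul_sq_le {ν₁ ν₂ : Measure SpaceTime}
    [SFinite ν₁] [SFinite ν₂] {F G : SpaceTime → ℂ} (e : ℝ) {D : ENNReal}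
    (hF : Integrable F ν₁) (hG : Integrable G ν₂)
    (hK : ∀ h : SpaceTime → ENNReal, Measurable h →
      ∫⁻ p, ∫⁻ p', h (p + e • p') ∂ν₂ ∂ν₁ ≤ D * ∫⁻ q, h q) :
    ∫⁻ z, ‖oscTransform ν₁ F z * oscTransform ν₂ G (e • z)‖ₑ ^ 2 ≤
      ENNReal.ofReal ((2 * Real.pi) ^ 4) * D * (∫⁻ p, ‖F p‖ₑ ^ 2 ∂ν₁) * ∫⁻ p, ‖G p‖ₑ ^ 2 ∂ν₂ := by
  set Φ : SpaceTime → ℂ := fun z => oscTransform ν₁ F z * oscTransform ν₂ G (e • z) with hΦ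
  have hΦc : Continuous Φ :=
    (continuous_oscTransform hF).mul ((continuous_oscTransform hG).comp (continuous_const_smul e))
  have hball : ∀ n : ℕ, ∫⁻ z in Metric.ball 0 n, ‖Φ z‖ₑ ^ 2 ≤
      ENNReal.ofReal ((2 * Real.pi) ^ 4) * D * (∫⁻ p, ‖F p‖ₑ ^ 2 ∂ν₁) *
        ∫⁻ p, ‖G p‖ₑ ^ 2 ∂ν₂ := by
    intro n
    -- The test function is the conjugate of the product itself. Truncation to a ball makes it
    -- integrable and `X` finite, so that a factor `X` can be cancelled from `X² ≤ K X`.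
    set φ : SpaceTime → ℂ :=
      (Metric.ball (0 : SpaceTime) (n : ℝ)).indicator (fun z => (starRingEnd ℂ) (Φ z)) with hφ
    have hcont : Continuous fun z => (starRingEnd ℂ) (Φ z) := Complex.continuous_conj.comp hΦc
    have hbd : ∃ C : ℝ, ∀ z ∈ Metric.ball (0 : SpaceTime) (n : ℝ), ‖(starRingEnd ℂ) (Φ z)‖ ≤ C := by
      obtain ⟨C, hC⟩ := (isCompact_closedBall (0 : SpaceTime) (n : ℝ)).exists_bound_of_continuousOn
        hcont.continuousOn
      exact ⟨C, fun z hz => hC z (Metric.ball_subset_closedBall hz)⟩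
    have hmem : ∀ p : ENNReal, MemLp φ p volume := by
      intro p
      obtain ⟨C, hC⟩ := hbd
      rw [hφ, memLp_indicator_iff_restrict measurableSet_ball]
      have : IsFiniteMeasure ((volume : Measure SpaceTime).restrict (Metric.ball 0 (n : ℝ))) :=
        ⟨by rw [Measure.restrict_apply_univ]; exact measure_ball_lt_top⟩
      exact MemLp.of_bound hcont.aestronglyMeasurable C
        ((ae_restrict_iff' measurableSet_ball).2 (Filter.Eventually.of_forall hC))
    have h1 : Integrable φ := memLp_one_iff_integrable.1 (hmem 1)
    have hsq : ∀ z, ‖φ z‖ₑ ^ 2 =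
        (Metric.ball (0 : SpaceTime) (n : ℝ)).indicator (fun z => ‖Φ z‖ₑ ^ 2) z := by
      intro z
      by_cases hz : z ∈ Metric.ball (0 : SpaceTime) (n : ℝ)
      · simp only [hφ, Set.indicator_of_mem hz]
        rw [← ofReal_norm, RCLike.norm_conj, ofReal_norm]
      · simp only [hφ, Set.indicator_of_notMem hz]
        simp
    set X := ∫⁻ z in Metric.ball 0 n, ‖Φ z‖ₑ ^ 2 with hX
    have hXφ : ∫⁻ z, ‖φ z‖ₑ ^ 2 = X := by
      simp_rw [hsq]
      rw [lintegral_indicator measurableSet_ball]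
    have hXtop : X ≠ ⊤ := by
      have h := (hmem 2).eLpNorm_lt_top
      rw [eLpNorm_lt_top_iff_lintegral_rpow_enorm_lt_top two_ne_zero ENNReal.ofNat_ne_top] at h
      rw [← hXφ]
      simpa using h.ne
    have hXint : X = ‖∫ z, φ z * Φ z‖ₑ := by
      have hre : ∀ z, φ z * Φ z = (((Metric.ball (0 : SpaceTime) (n : ℝ)).indicator
          (fun z => ‖Φ z‖ ^ 2) z : ℝ) : ℂ) := by
        intro z
        by_cases hz : z ∈ Metric.ball (0 : SpaceTime) (n : ℝ)
        · simp only [hφ, Set.indicator_of_mem hz]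
          rw [Complex.conj_mul']
          push_cast
          rfl
        · simp only [hφ, Set.indicator_of_notMem hz]
          simp
      simp_rw [hre]
      rw [integral_complex_ofReal, ← ofReal_norm, Complex.norm_real, Real.norm_of_nonneg
        (integral_nonneg fun z => Set.indicator_nonneg (fun _ _ => by positivity) z),
        integral_eq_lintegral_of_nonneg_ae
          (Filter.Eventually.of_forall fun z => Set.indicator_nonneg (fun _ _ => by positivity) z)
          ((Continuous.aestronglyMeasurable (by fun_prop)).indicator measurableSet_ball)]
      have : ∫⁻ z, ENNReal.ofReal ((Metric.ball (0 : SpaceTime) (n : ℝ)).indicator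
          (fun z => ‖Φ z‖ ^ 2) z) = X := by
        rw [← hXφ]
        refine lintegral_congr fun z => ?_
        rw [hsq]
        by_cases hz : z ∈ Metric.ball (0 : SpaceTime) (n : ℝ)
        · simp only [Set.indicator_of_mem hz]
          rw [ENNReal.ofReal_pow (norm_nonneg _), ofReal_norm]
        · simp [Set.indicator_of_notMem hz]
      rw [this, ENNReal.ofReal_toReal hXtop]
    refine le_of_sq_le_mul_self hXtop ?_
    have hle : X ≤ ∫⁻ w, (‖F w.1‖ₑ * ‖G w.2‖ₑ) * ‖oscTransform volume φ (w.1 + e • w.2)‖ₑ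
        ∂(ν₁.prod ν₂) := by
      rw [hXint, hΦ, integral_mul_oscTransform_mul e hF hG h1]
      refine (enorm_integral_le_lintegral_enorm _).trans (le_of_eq ?_)
      simp only [enorm_mul]
    have hadd : Continuous fun w : SpaceTime × SpaceTime => w.1 + e • w.2 := by fun_prop
    have hCS := lintegral_mul_sq_le (μ := ν₁.prod ν₂)
      (f := fun w => ‖F w.1‖ₑ * ‖G w.2‖ₑ)
      (g := fun w => ‖oscTransform volume φ (w.1 + e • w.2)‖ₑ)
      ((hF.1.comp_fst.enorm).mul (hG.1.comp_snd.enorm))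
      ((continuous_oscTransform h1).comp hadd).enorm.measurable.aemeasurable
    refine (pow_le_pow_left₀ zero_le hle 2).trans (hCS.trans ?_)
    simp only [mul_pow]
    rw [lintegral_prod_mul (hF.1.enorm.pow_const 2) (hG.1.enorm.pow_const 2)]
    -- The density hypothesis, applied to `|φ^|²`, reduces the second Cauchy–Schwarz factor to a
    -- Lebesgue integral, where Plancherel returns `X`.
    have hm : Measurable fun q => ‖oscTransform volume φ q‖ₑ ^ 2 :=
      (continuous_oscTransform h1).enorm.measurable.pow_const 2
    have hk := hK _ hm
    rw [lintegral_enorm_oscTransform_volume_sq h1 (hmem 2), hXφ] at hk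
    have hprod := lintegral_prod (μ := ν₁) (ν := ν₂)
      (fun w => ‖oscTransform volume φ (w.1 + e • w.2)‖ₑ ^ 2)
      (hm.comp hadd.measurable).aemeasurable
    rw [hprod]
    rw [mul_pow] at hk
    refine (mul_le_mul_right hk _).trans (le_of_eq ?_)
    ring
  have hU : (⋃ n : ℕ, Metric.ball (0 : SpaceTime) (n : ℝ)) = Set.univ := Metric.iUnion_ball_nat 0
  have hmono : Monotone fun n : ℕ => Metric.ball (0 : SpaceTime) (n : ℝ) :=
    fun a b hab => Metric.ball_subset_ball (by exact_mod_cast hab)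
  rw [← setLIntegral_univ, ← hU,
    setLIntegral_iUnion_of_directed _ (hmono.directed_le)]
  exact iSup_le hball

theorem oscTransform_neg (ν : Measure SpaceTime) (G : SpaceTime → ℂ) (z : SpaceTime) :
    oscTransform ν G (-z) = (starRingEnd ℂ) (oscTransform ν (fun p => (starRingEnd ℂ) (G p)) z) := by
  rw [oscTransform, oscTransform, ← integral_conj]
  refine integral_congr_ae (Filter.Eventually.of_forall fun p => ?_)
  simp only [map_mul, Complex.conj_conj, ← Complex.exp_conj, Complex.conj_I, Complex.conj_ofReal]
  congr 2
  simp only [Prod.fst_neg, Prod.snd_neg, inner_neg_left]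
  push_cast
  ring

/-- If the convolution of `ν₁` with `ν₂` or with its reflection has density at most `D`, then the
product of the oscillatory transforms is bounded in `L²`. -/
theorem lintegral_enorm_oscTransform_mul_sq_le {ν₁ ν₂ : Measure SpaceTime}
    [SFinite ν₁] [SFinite ν₂] {F G : SpaceTime → ℂ} {e : ℝ} (he : e = 1 ∨ e = -1) {D : ENNReal}
    (hF : Integrable F ν₁) (hG : Integrable G ν₂)
    (hK : ∀ h : SpaceTime → ENNReal, Measurable h →
      ∫⁻ p, ∫⁻ p', h (p + e • p') ∂ν₂ ∂ν₁ ≤ D * ∫⁻ q, h q) :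
    ∫⁻ z, ‖oscTransform ν₁ F z * oscTransform ν₂ G z‖ₑ ^ 2 ≤
      ENNReal.ofReal ((2 * Real.pi) ^ 4) * D * (∫⁻ p, ‖F p‖ₑ ^ 2 ∂ν₁) * ∫⁻ p, ‖G p‖ₑ ^ 2 ∂ν₂ := by
  have hc : ∀ w : ℂ, ‖(starRingEnd ℂ) w‖ₑ = ‖w‖ₑ := fun w => by
    rw [← ofReal_norm, RCLike.norm_conj, ofReal_norm]
  rcases he with rfl | rfl
  · simpa using lintegral_enorm_oscTransform_mul_smul_sq_le 1 hF hG hK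
  -- Evaluation at `-z` with `G` conjugated is the conjugate of the transform of `G` at `z`, hence
  -- has the same modulus.
  · have h := lintegral_enorm_oscTransform_mul_smul_sq_le (-1)
      (G := fun p => (starRingEnd ℂ) (G p)) hF
      ((Complex.conjLIE.toContinuousLinearEquiv : ℂ →L[ℝ] ℂ).integrable_comp hG) hK
    simp only [neg_smul, one_smul, oscTransform_neg, Complex.conj_conj, enorm_mul, hc] at h
    simpa only [enorm_mul] using h

/-! ### Changes of variables: squared distances to two points. -/

theorem lintegral_comp_affine (f : ℝ → ENNReal) (hf : Measurable f) (b : ℝ) {m : ℝ} (hm : m ≠ 0) :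
    ∫⁻ a, f (b + m * a) = ENNReal.ofReal |m|⁻¹ * ∫⁻ t, f t := by
  have h := Real.map_volume_mul_left hm
  have h1 : ∫⁻ a, f (b + m * a) = ∫⁻ t, f (b + t) ∂(Measure.map (m * ·) volume) := by
    rw [lintegral_map (f := fun t => f (b + t)) (by fun_prop) (by fun_prop)]
  rw [h1, h, lintegral_smul_measure, lintegral_add_left_eq_self, smul_eq_mul, abs_inv]

theorem lintegral_Ioi_comp_sq_add (H : ℝ → ENNReal) (c : ℝ) :
    ∫⁻ r in Set.Ioi (0 : ℝ), ENNReal.ofReal r * H (r ^ 2 + c) =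
      ENNReal.ofReal 2⁻¹ * ∫⁻ t in Set.Ioi c, H t := by
  have himg : (fun r : ℝ => r ^ 2 + c) '' Set.Ioi 0 = Set.Ioi c := by
    ext t
    constructor
    · rintro ⟨r, hr, rfl⟩
      have : 0 < r ^ 2 := pow_pos hr 2
      simpa using this
    · intro ht
      refine ⟨Real.sqrt (t - c), Real.sqrt_pos.2 (sub_pos.2 ht), ?_⟩
      simp only
      rw [Real.sq_sqrt (sub_pos.2 ht).le]
      ring
  have hinj : Set.InjOn (fun r : ℝ => r ^ 2 + c) (Set.Ioi 0) := by
    intro a ha b hb hab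
    simp only [add_left_inj] at hab
    exact (pow_left_inj₀ (le_of_lt ha) (le_of_lt hb) two_ne_zero).1 hab
  have h := lintegral_image_eq_lintegral_abs_deriv_mul (s := Set.Ioi (0 : ℝ))
    (f := fun r => r ^ 2 + c) (f' := fun r => 2 * r) measurableSet_Ioi
    (fun x _ => by simpa using ((hasDerivAt_pow 2 x).add_const c).hasDerivWithinAt) hinj H
  rw [himg] at h
  rw [h, ← lintegral_const_mul' _ _ ENNReal.ofReal_ne_top]
  refine setLIntegral_congr_fun measurableSet_Ioi fun r hr => ?_
  have hr' : (0 : ℝ) < r := hr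
  rw [← mul_assoc, ← ENNReal.ofReal_mul (by norm_num), abs_of_pos (by positivity)]
  congr 2
  ring

/-- Polar coordinates with `t = r²`: the angle gives `2π` and `r dr = dt / 2`. Only an inequality,
since the range `t > 0` is enlarged to the whole line. -/
theorem lintegral_comp_sq_add_sq_le (H : ℝ → ENNReal) (hH : Measurable H) :
    ∫⁻ w : ℝ × ℝ, H (w.1 ^ 2 + w.2 ^ 2) ≤ ENNReal.ofReal Real.pi * ∫⁻ r, H r := by
  rw [← lintegral_comp_polarCoord_symm, polarCoord_target, Measure.volume_eq_prod,
    ← Measure.prod_restrict]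
  have hsimp : ∀ p : ℝ × ℝ, ENNReal.ofReal p.1 • H ((polarCoord.symm p).1 ^ 2 +
      (polarCoord.symm p).2 ^ 2) = (ENNReal.ofReal p.1 * H (p.1 ^ 2 + 0)) * 1 := by
    intro p
    rw [mul_one, smul_eq_mul, polarCoord_symm_apply]
    congr 2
    simp only
    rw [mul_pow, mul_pow, ← mul_add, Real.cos_sq_add_sin_sq]
    ring
  simp_rw [hsimp]
  rw [lintegral_prod_mul (f := fun r : ℝ => ENNReal.ofReal r * H (r ^ 2 + 0)) (g := fun _ => 1)
    (Measurable.aemeasurable (by fun_prop)) aemeasurable_const, lintegral_Ioi_comp_sq_add]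
  simp only [lintegral_const, Measure.restrict_apply_univ, one_mul, Real.volume_Ioo]
  rw [mul_right_comm, ← ENNReal.ofReal_mul (by norm_num)]
  refine mul_le_mul' (ENNReal.ofReal_le_ofReal (by linarith)) (setLIntegral_le_lintegral _ _)

/-- Cylindrical coordinates about an axis with foci at distance `L`. With `P = a² + r`, the second
squared distance is `L² + P - 2La`, affine in `a` with slope `-2L`; this produces the factor `1 /
(2L)`. -/
theorem lintegral_cylinder_le {F : ℝ → ℝ → ENNReal} (hF : Measurable (Function.uncurry F))
    {L : ℝ} (hL : 0 < L) :
    ∫⁻ a : ℝ, ∫⁻ w : ℝ × ℝ, F (a ^ 2 + (w.1 ^ 2 + w.2 ^ 2)) ((L - a) ^ 2 + (w.1 ^ 2 + w.2 ^ 2)) ≤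
      ENNReal.ofReal (Real.pi / (2 * L)) * ∫⁻ P, ∫⁻ S, F P S := by
  have hcomp : ∀ {α : Type} [MeasurableSpace α] {u v : α → ℝ}, Measurable u → Measurable v →
      Measurable fun x => F (u x) (v x) := fun hu hv => hF.comp (hu.prodMk hv)
  calc _ ≤ ∫⁻ a : ℝ, ENNReal.ofReal Real.pi * ∫⁻ r, F (a ^ 2 + r) ((L - a) ^ 2 + r) :=
        lintegral_mono fun a => lintegral_comp_sq_add_sq_le
          (fun r => F (a ^ 2 + r) ((L - a) ^ 2 + r)) (hcomp (by fun_prop) (by fun_prop))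
    _ = ENNReal.ofReal Real.pi * ∫⁻ a : ℝ, ∫⁻ P, F P (L ^ 2 + P + (-(2 * L)) * a) := by
        rw [lintegral_const_mul' _ _ ENNReal.ofReal_ne_top]
        congr 1
        refine lintegral_congr fun a => ?_
        rw [← lintegral_add_left_eq_self (fun P => F P (L ^ 2 + P + (-(2 * L)) * a)) (a ^ 2)]
        refine lintegral_congr fun r => ?_
        congr 1
        ring
    _ = ENNReal.ofReal Real.pi * ∫⁻ P, ∫⁻ a : ℝ, F P (L ^ 2 + P + (-(2 * L)) * a) := by
        rw [lintegral_lintegral_swap]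
        exact (hcomp (by fun_prop) (by fun_prop)).aemeasurable
    _ = ENNReal.ofReal Real.pi * ∫⁻ P, ENNReal.ofReal |-(2 * L)|⁻¹ * ∫⁻ S, F P S := by
        congr 1
        refine lintegral_congr fun P => ?_
        exact lintegral_comp_affine (F P) (hcomp measurable_const measurable_id) _ (by
          simpa using hL.ne')
    _ = _ := by
        rw [lintegral_const_mul' _ _ ENNReal.ofReal_ne_top, ← mul_assoc,
          ← ENNReal.ofReal_mul Real.pi_pos.le, abs_neg, abs_of_pos (by positivity)]
        rfl

theorem lintegral_euclideanSpace_three (G : EuclideanSpace ℝ (Fin 3) → ENNReal)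
    (hG : Measurable G) :
    ∫⁻ x, G x = ∫⁻ a : ℝ, ∫⁻ w : ℝ × ℝ, G !₂[a, w.1, w.2] := by
  have h1 := (EuclideanSpace.volume_preserving_symm_measurableEquiv_toLp (Fin 3)).symm
  have h2 := (volume_preserving_piFinSuccAbove (fun _ : Fin 3 => ℝ) 0).symm
  have h3 := (volume_preserving_finTwoArrow ℝ).symm
  have h4 := (MeasurePreserving.id (volume : Measure ℝ)).prod h3
  have e : ∀ x : ℝ × ℝ × ℝ, (MeasurableEquiv.toLp 2 (Fin 3 → ℝ)).symm.symm
      ((MeasurableEquiv.piFinSuccAbove (fun _ : Fin 3 => ℝ) 0).symm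
        (Prod.map id (MeasurableEquiv.finTwoArrow (α := ℝ)).symm x)) =
      !₂[x.1, x.2.1, x.2.2] := by
    intro x
    ext i
    fin_cases i <;> rfl
  have hm : Measurable fun x : ℝ × ℝ × ℝ => G !₂[x.1, x.2.1, x.2.2] := by
    simp_rw [← e]
    refine hG.comp (((MeasurableEquiv.measurable _).comp (MeasurableEquiv.measurable _)).comp ?_)
    exact measurable_id.prodMap (MeasurableEquiv.measurable _)
  rw [← lintegral_prod (fun x : ℝ × ℝ × ℝ => G !₂[x.1, x.2.1, x.2.2]) hm.aemeasurable]
  simp_rw [← e]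
  exact (((h1.comp h2).comp h4).lintegral_comp hG).symm

/-- Integration in the two squared distances `‖y‖²` and `‖ξ - y‖²`. -/
theorem lintegral_norm_sq_norm_sub_sq_le {F : ℝ → ℝ → ENNReal}
    (hF : Measurable (Function.uncurry F)) {ξ : EuclideanSpace ℝ (Fin 3)} (hξ : ξ ≠ 0) :
    ∫⁻ y, F (‖y‖ ^ 2) (‖ξ - y‖ ^ 2) ≤
      ENNReal.ofReal (Real.pi / (2 * ‖ξ‖)) * ∫⁻ P, ∫⁻ S, F P S := by
  have hL : 0 < ‖ξ‖ := norm_pos_iff.2 hξ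
  -- Rotate so that `ξ` lies along the first axis.
  obtain ⟨b, hb⟩ := Orthonormal.exists_orthonormalBasis_extension_of_card_eq (𝕜 := ℝ)
    (E := EuclideanSpace ℝ (Fin 3)) (ι := Fin 3) (by simp) (v := fun _ => ‖ξ‖⁻¹ • ξ) (s := {0})
    (by
      refine ⟨fun i => ?_, fun i j hij => absurd (Subsingleton.elim i j) hij⟩
      simp [norm_smul, hL.ne'])
  have hξb : b.repr ξ = !₂[‖ξ‖, 0, 0] := by
    have h0 : ξ = ‖ξ‖ • b 0 := by
      rw [hb 0 rfl, smul_smul, mul_inv_cancel₀ hL.ne', one_smul]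
    conv_lhs => rw [h0]
    rw [map_smul, b.repr_self]
    ext i
    fin_cases i <;> simp
  have hm : Measurable fun x : EuclideanSpace ℝ (Fin 3) =>
      F (‖x‖ ^ 2) (‖!₂[‖ξ‖, 0, 0] - x‖ ^ 2) :=
    hF.comp (f := fun x : EuclideanSpace ℝ (Fin 3) => (‖x‖ ^ 2, ‖!₂[‖ξ‖, 0, 0] - x‖ ^ 2))
      (by fun_prop)
  have h1 : ∫⁻ y, F (‖y‖ ^ 2) (‖ξ - y‖ ^ 2) =
      ∫⁻ x : EuclideanSpace ℝ (Fin 3), F (‖x‖ ^ 2) (‖!₂[‖ξ‖, 0, 0] - x‖ ^ 2) := by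
    rw [← (b.measurePreserving_repr).lintegral_comp hm]
    refine lintegral_congr fun y => ?_
    rw [← hξb, ← map_sub, b.repr.norm_map, b.repr.norm_map]
  rw [h1, lintegral_euclideanSpace_three _ hm]
  refine (le_of_eq ?_).trans (lintegral_cylinder_le hF hL)
  refine lintegral_congr fun a => lintegral_congr fun w => ?_
  rw [EuclideanSpace.norm_sq_eq, EuclideanSpace.norm_sq_eq]
  simp [Fin.sum_univ_three, add_assoc]

/-! ### Convolutions of pieces of the hyperboloid measure. -/

/-- The height of the hyperboloid above `y`. -/
noncomputable def hypHeight (s : ℝ) (y : EuclideanSpace ℝ (Fin 3)) : ℝ :=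
  Real.sqrt (‖y‖ ^ 2 - s ^ 2)

/-- The density of the hyperboloid measure in the graph coordinate. -/
noncomputable def hypDensity (s : ℝ) : EuclideanSpace ℝ (Fin 3) → ENNReal :=
  {y | s < ‖y‖}.indicator fun y => ENNReal.ofReal (1 / Real.sqrt (‖y‖ ^ 2 - s ^ 2))

@[fun_prop]
theorem measurable_hypHeight (s : ℝ) : Measurable (hypHeight s) := by
  unfold hypHeight; fun_prop

theorem measurableSet_lt_norm (s : ℝ) :
    MeasurableSet {y : EuclideanSpace ℝ (Fin 3) | s < ‖y‖} :=
  measurableSet_lt measurable_const measurable_norm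

@[fun_prop]
theorem measurable_hypDensity (s : ℝ) : Measurable (hypDensity s) :=
  Measurable.indicator (by fun_prop) (measurableSet_lt_norm s)

theorem hypDensity_of_lt {s : ℝ} {y : EuclideanSpace ℝ (Fin 3)} (hy : s < ‖y‖) :
    hypDensity s y = ENNReal.ofReal (1 / Real.sqrt (‖y‖ ^ 2 - s ^ 2)) :=
  Set.indicator_of_mem (s := {y | s < ‖y‖}) hy _

theorem hypDensity_of_not_lt {s : ℝ} {y : EuclideanSpace ℝ (Fin 3)} (hy : ¬s < ‖y‖) :
    hypDensity s y = 0 :=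
  Set.indicator_of_notMem (s := {y | s < ‖y‖}) hy _

instance sFinite_hypMeasure (s : ℝ) : SFinite (hypMeasure s) := by
  unfold hypMeasure; infer_instance

theorem measurable_hypLift (s : ℝ) : Measurable (hypLift s) := by
  unfold hypLift; fun_prop

theorem lintegral_hypMeasure (s : ℝ) {h : SpaceTime → ENNReal} (hh : Measurable h) :
    ∫⁻ p, h p ∂(hypMeasure s) = ∫⁻ y, hypDensity s y * h (y, hypHeight s y) := by
  have hm : Measurable fun y : EuclideanSpace ℝ (Fin 3) =>
      ENNReal.ofReal (1 / Real.sqrt (‖y‖ ^ 2 - s ^ 2)) := by fun_prop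
  rw [hypMeasure, lintegral_map hh (measurable_hypLift s)]
  have hd := lintegral_withDensity_eq_lintegral_mul
    (volume.restrict {y : EuclideanSpace ℝ (Fin 3) | s < ‖y‖}) hm (hh.comp (measurable_hypLift s))
  simp only [Function.comp_def] at hd
  rw [hd, ← lintegral_indicator (measurableSet_lt_norm s)]
  refine lintegral_congr fun y => ?_
  by_cases hy : y ∈ {y : EuclideanSpace ℝ (Fin 3) | s < ‖y‖}
  · simp only [hypDensity, Set.indicator_of_mem hy]
    rfl
  · simp only [hypDensity, Set.indicator_of_notMem hy, zero_mul]

/-- The substitution `t = u² + c` has `dt = 2u du`, and the factor `u` cancels the singular weight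
`1 / √(t - c)`. -/
theorem lintegral_Ioi_sqrt_sub (K : ℝ → ENNReal) (c : ℝ) :
    ∫⁻ t in Set.Ioi c, ENNReal.ofReal (1 / Real.sqrt (t - c)) * K (Real.sqrt (t - c)) =
      2 * ∫⁻ u in Set.Ioi (0 : ℝ), K u := by
  have h := lintegral_Ioi_comp_sq_add
    (fun t => ENNReal.ofReal (1 / Real.sqrt (t - c)) * K (Real.sqrt (t - c))) c
  have h' : ∫⁻ r in Set.Ioi (0 : ℝ), ENNReal.ofReal r *
      (ENNReal.ofReal (1 / Real.sqrt (r ^ 2 + c - c)) * K (Real.sqrt (r ^ 2 + c - c))) =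
      ∫⁻ u in Set.Ioi (0 : ℝ), K u := by
    refine setLIntegral_congr_fun measurableSet_Ioi fun r hr => ?_
    have hr' : (0 : ℝ) < r := hr
    simp only [add_sub_cancel_right, Real.sqrt_sq hr'.le]
    rw [← mul_assoc, ← ENNReal.ofReal_mul hr'.le, mul_one_div_cancel hr'.ne', ENNReal.ofReal_one,
      one_mul]
  rw [h'] at h
  rw [h, ← mul_assoc, show (2 : ENNReal) = ENNReal.ofReal 2 by simp,
    ← ENNReal.ofReal_mul (by norm_num)]
  norm_num

/-- The convolution slice over a fixed `ξ`, in the height coordinates. -/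
theorem lintegral_hypDensity_mul_le {s : ℝ} (hs : 0 < s) {K : ℝ → ℝ → ENNReal}
    (hK : Measurable (Function.uncurry K)) {ξ : EuclideanSpace ℝ (Fin 3)} (hξ : ξ ≠ 0) :
    ∫⁻ y, hypDensity s y * (hypDensity s (ξ - y) * K (hypHeight s y) (hypHeight s (ξ - y))) ≤
      ENNReal.ofReal (2 * Real.pi / ‖ξ‖) *
        ∫⁻ u in Set.Ioi (0 : ℝ), ∫⁻ v in Set.Ioi (0 : ℝ), K u v := by
  set c : ℝ := s ^ 2 with hc
  set F : ℝ → ℝ → ENNReal := fun P S =>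
    (Set.Ioi c).indicator (fun P => ENNReal.ofReal (1 / Real.sqrt (P - c))) P *
      ((Set.Ioi c).indicator (fun S => ENNReal.ofReal (1 / Real.sqrt (S - c))) S *
        K (Real.sqrt (P - c)) (Real.sqrt (S - c))) with hF
  have hw : Measurable
      ((Set.Ioi c).indicator fun P : ℝ => ENNReal.ofReal (1 / Real.sqrt (P - c))) :=
    Measurable.indicator (by fun_prop) measurableSet_Ioi
  have hFm : Measurable (Function.uncurry F) := by
    refine (hw.comp measurable_fst).mul ((hw.comp measurable_snd).mul ?_)
    exact hK.comp (f := fun x : ℝ × ℝ => (Real.sqrt (x.1 - c), Real.sqrt (x.2 - c))) (by fun_prop)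
  have hdens : ∀ y : EuclideanSpace ℝ (Fin 3), hypDensity s y =
      (Set.Ioi c).indicator (fun P => ENNReal.ofReal (1 / Real.sqrt (P - c))) (‖y‖ ^ 2) := by
    intro y
    by_cases hy : s < ‖y‖
    · have hy' : ‖y‖ ^ 2 ∈ Set.Ioi c := pow_lt_pow_left₀ hy hs.le two_ne_zero
      rw [Set.indicator_of_mem hy', hypDensity_of_lt hy]
    · have hy' : ‖y‖ ^ 2 ∉ Set.Ioi c := fun h => hy (lt_of_pow_lt_pow_left₀ 2 (norm_nonneg _) h)
      rw [Set.indicator_of_notMem hy', hypDensity_of_not_lt hy]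
  have h1 := lintegral_norm_sq_norm_sub_sq_le hFm hξ
  have h2 : ∀ K' : ℝ → ENNReal, ∫⁻ S, (Set.Ioi c).indicator
      (fun S => ENNReal.ofReal (1 / Real.sqrt (S - c))) S * K' (Real.sqrt (S - c)) =
      2 * ∫⁻ v in Set.Ioi (0 : ℝ), K' v := by
    intro K'
    rw [← lintegral_Ioi_sqrt_sub K' c, ← lintegral_indicator measurableSet_Ioi]
    refine lintegral_congr fun S => ?_
    by_cases hS : S ∈ Set.Ioi c
    · simp only [Set.indicator_of_mem hS]
    · simp only [Set.indicator_of_notMem hS, zero_mul]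
  have h3 : ∫⁻ P, ∫⁻ S, F P S =
      2 * (2 * ∫⁻ u in Set.Ioi (0 : ℝ), ∫⁻ v in Set.Ioi (0 : ℝ), K u v) := by
    rw [← lintegral_const_mul' _ _ (by simp), ← h2 fun u => 2 * ∫⁻ v in Set.Ioi (0 : ℝ), K u v]
    refine lintegral_congr fun P => ?_
    rw [← h2 (K (Real.sqrt (P - c)))]
    refine lintegral_const_mul _ (hw.mul ?_)
    exact hK.comp (f := fun x : ℝ => (Real.sqrt (P - c), Real.sqrt (x - c))) (by fun_prop)
  rw [h3] at h1
  calc _ = ∫⁻ y, F (‖y‖ ^ 2) (‖ξ - y‖ ^ 2) := by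
        refine lintegral_congr fun y => ?_
        rw [hdens, hdens]
        rfl
    _ ≤ _ := h1
    _ = _ := by
        have h22 : ∀ x : ENNReal, 2 * (2 * x) = ENNReal.ofReal 4 * x := by
          intro x
          rw [← mul_assoc]
          norm_num
        rw [h22, ← mul_assoc, ← ENNReal.ofReal_mul (by positivity)]
        congr 2
        ring

/-- Integration along the lines `u + e v = τ`. -/
theorem lintegral_indicator_mul_comp_add_le {e : ℝ} (he : e = 1 ∨ e = -1) {H : ℝ → ENNReal}
    (hH : Measurable H) {M : Set (ℝ × ℝ)} (hM : MeasurableSet M) {V : ENNReal}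
    (hV : ∀ τ : ℝ, volume {u : ℝ | 0 < u ∧ 0 < e * (τ - u) ∧ (u, e * (τ - u)) ∈ M} ≤ V) :
    ∫⁻ u in Set.Ioi (0 : ℝ), ∫⁻ v in Set.Ioi (0 : ℝ), M.indicator 1 (u, v) * H (u + e * v) ≤
      V * ∫⁻ τ, H τ := by
  have he2 : e * e = 1 := by rcases he with rfl | rfl <;> norm_num
  have he0 : e ≠ 0 := by rintro rfl; simp at he2
  have heabs : |e| = 1 := by rcases he with rfl | rfl <;> simp
  set M' : Set (ℝ × ℝ) := (Set.Ioi 0 ×ˢ Set.Ioi 0) ∩ M with hM'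
  have hM'm : MeasurableSet M' := (measurableSet_Ioi.prod measurableSet_Ioi).inter hM
  have hind : Measurable (M'.indicator (1 : ℝ × ℝ → ENNReal)) := measurable_one.indicator hM'm
  calc _ = ∫⁻ u, ∫⁻ v, M'.indicator 1 (u, v) * H (u + e * v) := by
        rw [← lintegral_indicator measurableSet_Ioi]
        refine lintegral_congr fun u => ?_
        by_cases hu : u ∈ Set.Ioi (0 : ℝ)
        · rw [Set.indicator_of_mem hu, ← lintegral_indicator measurableSet_Ioi]
          refine lintegral_congr fun v => ?_
          by_cases hv : v ∈ Set.Ioi (0 : ℝ)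
          · rw [Set.indicator_of_mem hv]
            congr 1
            by_cases hm : (u, v) ∈ M
            · rw [Set.indicator_of_mem hm, Set.indicator_of_mem (show (u, v) ∈ M' from
                ⟨⟨hu, hv⟩, hm⟩)]
            · rw [Set.indicator_of_notMem hm, Set.indicator_of_notMem (fun h => hm h.2)]
          · rw [Set.indicator_of_notMem hv, Set.indicator_of_notMem (fun h => hv h.1.2), zero_mul]
        · rw [Set.indicator_of_notMem hu]
          symm
          rw [lintegral_eq_zero_iff' (by fun_prop)]
          refine Filter.Eventually.of_forall fun v => ?_
          simp only
          rw [Set.indicator_of_notMem (fun h => hu h.1.1), zero_mul]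
          rfl
    _ = ∫⁻ u, ∫⁻ τ, M'.indicator 1 (u, e * (τ - u)) * H τ := by
        refine lintegral_congr fun u => ?_
        have h := lintegral_comp_affine (fun τ => M'.indicator 1 (u, e * (τ - u)) * H τ)
          ((hind.comp (f := fun τ : ℝ => (u, e * (τ - u))) (by fun_prop)).mul hH) u he0
        rw [heabs, inv_one, ENNReal.ofReal_one, one_mul] at h
        rw [← h]
        refine lintegral_congr fun v => ?_
        rw [add_sub_cancel_left, ← mul_assoc, he2, one_mul]
    _ = ∫⁻ τ, ∫⁻ u, M'.indicator 1 (u, e * (τ - u)) * H τ := by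
        rw [lintegral_lintegral_swap]
        exact ((hind.comp (f := fun x : ℝ × ℝ => (x.1, e * (x.2 - x.1))) (by fun_prop)).mul
          (hH.comp measurable_snd)).aemeasurable
    _ ≤ ∫⁻ τ, V * H τ := by
        refine lintegral_mono fun τ => ?_
        simp only
        have hmτ : Measurable fun u : ℝ => (u, e * (τ - u)) := by fun_prop
        rw [lintegral_mul_const (f := fun u => M'.indicator 1 (u, e * (τ - u))) _ (hind.comp hmτ)]
        refine mul_le_mul_left ?_ _
        have : ∀ u : ℝ, M'.indicator (1 : ℝ × ℝ → ENNReal) (u, e * (τ - u)) =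
            ((fun u : ℝ => (u, e * (τ - u))) ⁻¹' M').indicator 1 u := fun u => rfl
        simp_rw [this]
        rw [lintegral_indicator_one (hmτ hM'm)]
        refine (measure_mono fun u hu => ?_).trans (hV τ)
        exact ⟨hu.1.1, hu.1.2, hu.2⟩
    _ = _ := lintegral_const_mul _ hH

/-- A bound for the density of the twisted convolution of two pieces of the hyperboloid measure. -/
theorem lintegral_lintegral_hypMeasure_restrict_le {s : ℝ} (hs : 0 < s) {e : ℝ}
    (he : e = 1 ∨ e = -1) {A B : Set (EuclideanSpace ℝ (Fin 3))} (hA : MeasurableSet A)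
    (hB : MeasurableSet B) {D : ENNReal}
    (hD : ∀ a ∈ A, ∀ b ∈ B, a + e • b ≠ 0 → ∃ M : Set (ℝ × ℝ), MeasurableSet M ∧
      (∀ y ∈ A, e • (a + e • b - y) ∈ B → s < ‖y‖ → s < ‖a + e • b - y‖ →
        (hypHeight s y, hypHeight s (a + e • b - y)) ∈ M) ∧
      ∀ τ : ℝ, ENNReal.ofReal (2 * Real.pi / ‖a + e • b‖) *
        volume {u : ℝ | 0 < u ∧ 0 < e * (τ - u) ∧ (u, e * (τ - u)) ∈ M} ≤ D)
    {h : SpaceTime → ENNReal} (hh : Measurable h) :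
    ∫⁻ p, ∫⁻ p', h (p + e • p') ∂((hypMeasure s).restrict (Prod.fst ⁻¹' B))
      ∂((hypMeasure s).restrict (Prod.fst ⁻¹' A)) ≤ D * ∫⁻ q, h q := by
  have he2 : e * e = 1 := by rcases he with rfl | rfl <;> norm_num
  have hrestr : ∀ {S : Set (EuclideanSpace ℝ (Fin 3))}, MeasurableSet S →
      ∀ {g : SpaceTime → ENNReal}, Measurable g →
      ∫⁻ p, g p ∂((hypMeasure s).restrict (Prod.fst ⁻¹' S)) =
        ∫⁻ y, S.indicator 1 y * (hypDensity s y * g (y, hypHeight s y)) := by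
    intro S hS g hg
    rw [← lintegral_indicator (measurable_fst hS), lintegral_hypMeasure s
      (hg.indicator (measurable_fst hS))]
    refine lintegral_congr fun y => ?_
    by_cases hy : y ∈ S
    · rw [Set.indicator_of_mem hy, Set.indicator_of_mem (show (y, hypHeight s y) ∈ Prod.fst ⁻¹' S
        from hy), Pi.one_apply, one_mul]
    · rw [Set.indicator_of_notMem hy, Set.indicator_of_notMem (show (y, hypHeight s y) ∉
        Prod.fst ⁻¹' S from hy), zero_mul, mul_zero]
  have hiA : Measurable (A.indicator (1 : EuclideanSpace ℝ (Fin 3) → ENNReal)) :=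
    measurable_one.indicator hA
  have hiB : Measurable (B.indicator (1 : EuclideanSpace ℝ (Fin 3) → ENNReal)) :=
    measurable_one.indicator hB
  have hin : ∀ p : SpaceTime, Measurable fun p' : SpaceTime => h (p + e • p') :=
    fun p => hh.comp (by fun_prop)
  have hnorm : ∀ w : EuclideanSpace ℝ (Fin 3), ‖e • w‖ = ‖w‖ := by
    intro w
    rw [norm_smul]
    rcases he with rfl | rfl <;> simp
  have hdens : ∀ w, hypDensity s (e • w) = hypDensity s w := by
    intro w
    by_cases hw : s < ‖w‖
    · rw [hypDensity_of_lt hw, hypDensity_of_lt (by rwa [hnorm]), hnorm]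
    · rw [hypDensity_of_not_lt hw, hypDensity_of_not_lt (by rwa [hnorm])]
  have hheight : ∀ w, hypHeight s (e • w) = hypHeight s w := by
    intro w; rw [hypHeight, hypHeight, hnorm]
  have hsub : ∀ (y : EuclideanSpace ℝ (Fin 3)) (g : EuclideanSpace ℝ (Fin 3) → ENNReal),
      ∫⁻ y', g y' = ∫⁻ ξ, g (e • (ξ - y)) := by
    intro y g
    rcases he with rfl | rfl
    · simp only [one_smul]
      exact (lintegral_sub_right_eq_self g y).symm
    · simp only [neg_smul, one_smul, neg_sub]
      exact (lintegral_sub_left_eq_self g y).symm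
  have hcomp : ∀ y ξ : EuclideanSpace ℝ (Fin 3),
      (y, hypHeight s y) + e • (e • (ξ - y), hypHeight s (ξ - y)) =
        (ξ, hypHeight s y + e * hypHeight s (ξ - y)) := by
    intro y ξ
    simp [smul_smul, he2]
  calc _ = ∫⁻ y, A.indicator 1 y * (hypDensity s y * ∫⁻ y', B.indicator 1 y' *
        (hypDensity s y' * h ((y, hypHeight s y) + e • (y', hypHeight s y')))) := by
        rw [hrestr hA]
        · refine lintegral_congr fun y => ?_
          rw [hrestr hB (hin _)]
        · exact Measurable.lintegral_prod_right' (f := fun x : SpaceTime × SpaceTime =>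
            h (x.1 + e • x.2)) (hh.comp (by fun_prop))
    _ = ∫⁻ y, ∫⁻ ξ, A.indicator 1 y * (hypDensity s y * (B.indicator 1 (e • (ξ - y)) *
        (hypDensity s (ξ - y) * h (ξ, hypHeight s y + e * hypHeight s (ξ - y))))) := by
        refine lintegral_congr fun y => ?_
        rw [hsub y]
        simp only [hdens, hheight, hcomp]
        have hm1 : Measurable fun ξ => B.indicator 1 (e • (ξ - y)) *
            (hypDensity s (ξ - y) * h (ξ, hypHeight s y + e * hypHeight s (ξ - y))) := by
          refine (hiB.comp (by fun_prop)).mul (Measurable.mul ?_ (hh.comp ?_)) <;> fun_prop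
        rw [lintegral_const_mul _ (hm1.const_mul _), lintegral_const_mul _ hm1]
    _ = ∫⁻ ξ, ∫⁻ y, A.indicator 1 y * (hypDensity s y * (B.indicator 1 (e • (ξ - y)) *
        (hypDensity s (ξ - y) * h (ξ, hypHeight s y + e * hypHeight s (ξ - y))))) := by
        rw [lintegral_lintegral_swap]
        refine Measurable.aemeasurable ?_
        refine (hiA.comp measurable_fst).mul (((measurable_hypDensity s).comp measurable_fst).mul
          ((hiB.comp (by fun_prop)).mul (((measurable_hypDensity s).comp
            (measurable_snd.sub measurable_fst)).mul (hh.comp ?_))))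
        exact measurable_snd.prodMk (((measurable_hypHeight s).comp measurable_fst).add
          (((measurable_hypHeight s).comp (measurable_snd.sub measurable_fst)).const_mul e))
    _ ≤ ∫⁻ ξ : EuclideanSpace ℝ (Fin 3), D * ∫⁻ τ, h (ξ, τ) := by
        refine lintegral_mono_ae ?_
        have hae : ∀ᵐ ξ : EuclideanSpace ℝ (Fin 3), ξ ≠ 0 := by
          simp [ae_iff]
        filter_upwards [hae] with ξ hξ
        -- The hypothesis `hD` speaks only of `ξ` of the form `a + e b`; over every other `ξ` the
        -- slice is empty.
        by_cases hex : ∃ a ∈ A, e • (ξ - a) ∈ B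
        · obtain ⟨a, ha, hb⟩ := hex
          have hab : a + e • (e • (ξ - a)) = ξ := by
            rw [smul_smul, he2, one_smul]; abel
          obtain ⟨M, hMm, hMin, hMV⟩ := hD a ha _ hb (by rwa [hab])
          rw [hab] at hMin hMV
          have hH : Measurable fun τ => h (ξ, τ) := hh.comp (by fun_prop)
          have hKm : Measurable (Function.uncurry fun u v : ℝ =>
              M.indicator (1 : ℝ × ℝ → ENNReal) (u, v) * h (ξ, u + e * v)) :=
            ((measurable_one.indicator hMm).mul (hh.comp (by fun_prop)))
          have hslice := lintegral_hypDensity_mul_le hs hKm hξ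
          have hpos : ENNReal.ofReal (2 * Real.pi / ‖ξ‖) ≠ 0 := by
            have := norm_pos_iff.2 hξ
            have := Real.pi_pos
            rw [ne_eq, ENNReal.ofReal_eq_zero, not_le]
            positivity
          have hline := lintegral_indicator_mul_comp_add_le he hH hMm
            (V := D / ENNReal.ofReal (2 * Real.pi / ‖ξ‖)) (fun τ => by
              rw [ENNReal.le_div_iff_mul_le (Or.inl hpos) (Or.inl ENNReal.ofReal_ne_top), mul_comm]
              exact hMV τ)
          refine le_trans ?_ (hslice.trans ((mul_le_mul_right hline _).trans (le_of_eq ?_)))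
          · refine lintegral_mono fun y => ?_
            simp only
            by_cases hyA : y ∈ A
            swap
            · rw [Set.indicator_of_notMem hyA, zero_mul]; exact zero_le
            by_cases hyB : e • (ξ - y) ∈ B
            swap
            · rw [Set.indicator_of_notMem hyB, zero_mul, mul_zero, mul_zero]; exact zero_le
            by_cases h1 : s < ‖y‖
            swap
            · rw [hypDensity_of_not_lt h1, zero_mul,
                mul_zero]
              exact zero_le
            by_cases h2 : s < ‖ξ - y‖
            swap
            · rw [hypDensity_of_not_lt h2, zero_mul, mul_zero, mul_zero, mul_zero]
              exact zero_le
            rw [Set.indicator_of_mem hyA, Set.indicator_of_mem hyB,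
              Set.indicator_of_mem (hMin y hyA hyB h1 h2)]
            simp
          · rw [← mul_assoc, ENNReal.mul_div_cancel hpos ENNReal.ofReal_ne_top]
        · refine le_trans (le_of_eq ?_) zero_le
          rw [lintegral_eq_zero_iff']
          · refine Filter.Eventually.of_forall fun y => ?_
            by_cases hyA : y ∈ A
            · have hyB : e • (ξ - y) ∉ B := fun hB => hex ⟨y, hyA, hB⟩
              simp [Set.indicator_of_notMem hyB]
            · simp [Set.indicator_of_notMem hyA]
          · refine Measurable.aemeasurable ?_
            refine hiA.mul ((measurable_hypDensity s).mul ((hiB.comp (by fun_prop)).mul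
              (Measurable.mul (by fun_prop) (hh.comp (by fun_prop)))))
    _ = _ := by
        rw [lintegral_const_mul, Measure.volume_eq_prod, lintegral_prod _ hh.aemeasurable]
        exact Measurable.lintegral_prod_right' (f := fun x : SpaceTime => h x) hh

theorem eLpNorm_two_sq {α : Type*} [MeasurableSpace α] (f : α → ℂ) (μ : Measure α) :
    eLpNorm f 2 μ ^ 2 = ∫⁻ a, ‖f a‖ₑ ^ 2 ∂μ := by
  rw [eLpNorm_eq_lintegral_rpow_enorm_toReal two_ne_zero ENNReal.ofNat_ne_top,
    ← ENNReal.rpow_natCast, ← ENNReal.rpow_mul]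
  simp

/-- The `L²` bound for products of extensions of functions over `A` and `B`, in terms of a bound
for the slices of the convolution. -/
theorem eLpNorm_oscTransform_mul_le {s : ℝ} (hs : 0 < s) {e : ℝ}
    (he : e = 1 ∨ e = -1) {A B : Set (EuclideanSpace ℝ (Fin 3))} (hA : MeasurableSet A)
    (hB : MeasurableSet B) {d : ℝ}
    (hD : ∀ a ∈ A, ∀ b ∈ B, a + e • b ≠ 0 → ∃ M : Set (ℝ × ℝ), MeasurableSet M ∧
      (∀ y ∈ A, e • (a + e • b - y) ∈ B → s < ‖y‖ → s < ‖a + e • b - y‖ →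
        (hypHeight s y, hypHeight s (a + e • b - y)) ∈ M) ∧
      ∀ τ : ℝ, ENNReal.ofReal (2 * Real.pi / ‖a + e • b‖) *
        volume {u : ℝ | 0 < u ∧ 0 < e * (τ - u) ∧ (u, e * (τ - u)) ∈ M} ≤ ENNReal.ofReal d)
    {F G : SpaceTime → ℂ}
    (hF : Integrable F ((hypMeasure s).restrict (Prod.fst ⁻¹' A)))
    (hG : Integrable G ((hypMeasure s).restrict (Prod.fst ⁻¹' B))) :
    eLpNorm (fun z => oscTransform ((hypMeasure s).restrict (Prod.fst ⁻¹' A)) F z *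
        oscTransform ((hypMeasure s).restrict (Prod.fst ⁻¹' B)) G z) 2 volume ≤
      ENNReal.ofReal ((2 * Real.pi) ^ 2 * Real.sqrt d) *
        eLpNorm F 2 ((hypMeasure s).restrict (Prod.fst ⁻¹' A)) *
        eLpNorm G 2 ((hypMeasure s).restrict (Prod.fst ⁻¹' B)) := by
  have h := lintegral_enorm_oscTransform_mul_sq_le he hF hG
    (fun h hh => lintegral_lintegral_hypMeasure_restrict_le hs he hA hB hD hh)
  rw [← eLpNorm_two_sq, ← eLpNorm_two_sq, ← eLpNorm_two_sq,
    ← ENNReal.ofReal_mul (by positivity)] at h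
  have hd : ENNReal.ofReal ((2 * Real.pi) ^ 4 * d) ≤
      ENNReal.ofReal ((2 * Real.pi) ^ 2 * Real.sqrt d) ^ 2 := by
    rw [← ENNReal.ofReal_pow (by positivity)]
    rcases le_or_gt 0 d with h0 | h0
    · refine ENNReal.ofReal_le_ofReal (le_of_eq ?_)
      rw [mul_pow _ (Real.sqrt d), Real.sq_sqrt h0]
      ring
    · rw [ENNReal.ofReal_of_nonpos (mul_nonpos_of_nonneg_of_nonpos (by positivity) h0.le)]
      exact zero_le
  refine (ENNReal.pow_le_pow_left_iff (n := 2) two_ne_zero).1 (h.trans ?_)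
  rw [mul_pow _ (eLpNorm G 2 _), mul_pow _ (eLpNorm F 2 _)]
  exact mul_le_mul_left (mul_le_mul_left hd _) _

/-! ### Slice bounds away from the origin and away from the equator. -/

/-- The slice bound when the sums `a + e b` stay away from the origin. -/
theorem exists_slice_of_le_norm {s : ℝ} {e : ℝ}
    {A B : Set (EuclideanSpace ℝ (Fin 3))} {R c : ℝ} (hc : 0 < c)
    (hAR : ∀ a ∈ A, ‖a‖ ≤ R) (hAB : ∀ a ∈ A, ∀ b ∈ B, c ≤ ‖a + e • b‖) :
    ∀ a ∈ A, ∀ b ∈ B, a + e • b ≠ 0 → ∃ M : Set (ℝ × ℝ), MeasurableSet M ∧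
      (∀ y ∈ A, e • (a + e • b - y) ∈ B → s < ‖y‖ → s < ‖a + e • b - y‖ →
        (hypHeight s y, hypHeight s (a + e • b - y)) ∈ M) ∧
      ∀ τ : ℝ, ENNReal.ofReal (2 * Real.pi / ‖a + e • b‖) *
        volume {u : ℝ | 0 < u ∧ 0 < e * (τ - u) ∧ (u, e * (τ - u)) ∈ M} ≤
          ENNReal.ofReal (2 * Real.pi / c * R) := by
  intro a ha b hb _
  refine ⟨{x | x.1 ≤ R}, measurableSet_le measurable_fst measurable_const, fun y hy _ _ _ => ?_,
    fun τ => ?_⟩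
  · have h1 : hypHeight s y ≤ ‖y‖ := by
      rw [hypHeight]
      refine Real.sqrt_le_iff.2 ⟨norm_nonneg _, ?_⟩
      nlinarith [sq_nonneg s]
    exact h1.trans (hAR y hy)
  · have hsub : {u : ℝ | 0 < u ∧ 0 < e * (τ - u) ∧ (u, e * (τ - u)) ∈ {x : ℝ × ℝ | x.1 ≤ R}} ⊆
        Set.Ioc 0 R := fun u hu => ⟨hu.1, hu.2.2⟩
    have hpi := Real.pi_pos
    have hab := hAB a ha b hb
    calc _ ≤ ENNReal.ofReal (2 * Real.pi / c) * ENNReal.ofReal R := by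
          refine mul_le_mul' (ENNReal.ofReal_le_ofReal ?_) ((measure_mono hsub).trans ?_)
          · exact div_le_div_of_nonneg_left (by positivity) hc hab
          · rw [Real.volume_Ioc, sub_zero]
      _ = _ := (ENNReal.ofReal_mul (by positivity)).symm

/-- The slope `v / √(v² + s²)` is at least `1/2` exactly when `s² ≤ 3v²`. The proof is the
difference of squares, with each root bounded by twice its height. -/
theorem half_sub_le_sqrt_sq_add_sub {s v w : ℝ} (hw : 0 < w) (hwv : w ≤ v)
    (hsw : s ^ 2 ≤ 3 * w ^ 2) :
    (v - w) / 2 ≤ Real.sqrt (v ^ 2 + s ^ 2) - Real.sqrt (w ^ 2 + s ^ 2) := by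
  set p := Real.sqrt (v ^ 2 + s ^ 2) with hp
  set q := Real.sqrt (w ^ 2 + s ^ 2) with hq
  have hp2 : p ^ 2 = v ^ 2 + s ^ 2 := Real.sq_sqrt (by positivity)
  have hq2 : q ^ 2 = w ^ 2 + s ^ 2 := Real.sq_sqrt (by positivity)
  have hwv2 : w ^ 2 ≤ v ^ 2 := pow_le_pow_left₀ hw.le hwv 2
  have hpv : p ≤ 2 * v := Real.sqrt_le_iff.2 ⟨by linarith, by nlinarith⟩
  have hqw : q ≤ 2 * w := Real.sqrt_le_iff.2 ⟨by linarith, by nlinarith⟩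
  have hpq : q ≤ p := Real.sqrt_le_sqrt (by linarith)
  have h1 : (p - q) * (p + q) = (v - w) * (v + w) := by nlinarith
  have h2 : (p - q) * (p + q) ≤ (p - q) * (2 * (v + w)) :=
    mul_le_mul_of_nonneg_left (by linarith) (by linarith)
  have h3 : (v - w) * (v + w) ≤ (2 * (p - q)) * (v + w) := by linarith
  have h4 := le_of_mul_le_mul_right h3 (by linarith)
  linarith

theorem norm_eq_sqrt_hypHeight {s : ℝ} (hs : 0 < s) {y : EuclideanSpace ℝ (Fin 3)}
    (hy : s < ‖y‖) : Real.sqrt (hypHeight s y ^ 2 + s ^ 2) = ‖y‖ := by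
  rw [hypHeight, Real.sq_sqrt (by nlinarith), sub_add_cancel, Real.sqrt_sq (norm_nonneg _)]

/-- The slice bound when one of the factors stays away from the equator. -/
theorem exists_slice_of_two_mul_le_norm {s : ℝ} (hs : 0 < s)
    {A B : Set (EuclideanSpace ℝ (Fin 3))} (hB : ∀ b ∈ B, 2 * s ≤ ‖b‖) :
    ∀ a ∈ A, ∀ b ∈ B, a + (1 : ℝ) • b ≠ 0 → ∃ M : Set (ℝ × ℝ), MeasurableSet M ∧
      (∀ y ∈ A, (1 : ℝ) • (a + (1 : ℝ) • b - y) ∈ B → s < ‖y‖ → s < ‖a + (1 : ℝ) • b - y‖ →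
        (hypHeight s y, hypHeight s (a + (1 : ℝ) • b - y)) ∈ M) ∧
      ∀ τ : ℝ, ENNReal.ofReal (2 * Real.pi / ‖a + (1 : ℝ) • b‖) *
        volume {u : ℝ | 0 < u ∧ 0 < 1 * (τ - u) ∧ (u, 1 * (τ - u)) ∈ M} ≤
          ENNReal.ofReal (8 * Real.pi) := by
  intro a ha b hb hab
  simp only [one_smul, one_mul] at hab ⊢
  set ξ := a + b with hξ
  have hL : 0 < ‖ξ‖ := norm_pos_iff.2 hab
  set ψ : ℝ × ℝ → ℝ := fun x => Real.sqrt (x.1 ^ 2 + s ^ 2) - Real.sqrt (x.2 ^ 2 + s ^ 2) with hψ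
  have hψm : Measurable ψ := by fun_prop
  -- The first condition says that the second height is not small; the second is the triangle
  -- inequality `||y| - |ξ - y|| ≤ |ξ|` written in heights.
  refine ⟨{x | s ^ 2 ≤ 3 * x.2 ^ 2} ∩ {x | |ψ x| ≤ ‖ξ‖},
    (measurableSet_le (by fun_prop) (by fun_prop)).inter
      (measurableSet_le (by fun_prop) measurable_const), fun y hy hyB h1 h2 => ⟨?_, ?_⟩,
    fun τ => ?_⟩
  · have h3 := hB _ hyB
    have h4 : hypHeight s (ξ - y) ^ 2 = ‖ξ - y‖ ^ 2 - s ^ 2 := Real.sq_sqrt (by nlinarith)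
    simp only [Set.mem_ofPred_eq]
    nlinarith
  · simp only [Set.mem_ofPred_eq, hψ]
    rw [norm_eq_sqrt_hypHeight hs h1, norm_eq_sqrt_hypHeight hs h2]
    have h3 := abs_norm_sub_norm_le y (y - ξ)
    rwa [sub_sub_cancel, norm_sub_rev y ξ] at h3
  · have hdiam : volume {u : ℝ | 0 < u ∧ 0 < τ - u ∧
        (u, τ - u) ∈ {x : ℝ × ℝ | s ^ 2 ≤ 3 * x.2 ^ 2} ∩ {x | |ψ x| ≤ ‖ξ‖}} ≤
        ENNReal.ofReal (4 * ‖ξ‖) := by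
      refine (Real.volume_le_diam _).trans (Metric.ediam_le ?_)
      -- Along `u + v = τ` the function `ψ` increases at rate at least `1/2`: its first term
      -- increases, and its second grows by the slope bound. Its values lie in an interval of length
      -- `2|ξ|`, hence the bound `4|ξ|`, which cancels `1 / |ξ|`.
      have key : ∀ u v : ℝ, u ≤ v → 0 < u → 0 < τ - v → s ^ 2 ≤ 3 * (τ - v) ^ 2 →
          |ψ (u, τ - u)| ≤ ‖ξ‖ → |ψ (v, τ - v)| ≤ ‖ξ‖ → v - u ≤ 4 * ‖ξ‖ := by
        intro u v huv hu hv h3 h4 h5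
        have h6 := half_sub_le_sqrt_sq_add_sub hv (v := τ - u) (by linarith) h3
        have h7 : Real.sqrt (u ^ 2 + s ^ 2) ≤ Real.sqrt (v ^ 2 + s ^ 2) :=
          Real.sqrt_le_sqrt (by nlinarith)
        have h8 := (abs_le.1 h4).1
        have h9 := (abs_le.1 h5).2
        simp only [hψ] at h8 h9
        linarith
      rintro u ⟨hu1, hu2, hu3, hu4⟩ v ⟨hv1, hv2, hv3, hv4⟩
      rw [edist_dist, Real.dist_eq]
      refine ENNReal.ofReal_le_ofReal (abs_le.2 ?_)
      rcases le_total u v with h | h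
      · have := key u v h hu1 hv2 hv3 hu4 hv4
        constructor <;> linarith
      · have := key v u h hv1 hu2 hu3 hv4 hu4
        constructor <;> linarith
    refine (mul_le_mul_right hdiam _).trans (le_of_eq ?_)
    rw [← ENNReal.ofReal_mul (by positivity)]
    congr 1
    field_simp
    ring

/-- The weight is singular on `|y| = s` but integrable. The two-distance change of variables shows
it with an auxiliary `ξ ≠ 0`, the variable `|ξ - y|²` ranging over a bounded interval. -/
theorem hypMeasure_preimage_closedBall_lt_top {s : ℝ} (hs : 0 < s) {R : ℝ} (hR : 0 ≤ R) :
    hypMeasure s (Prod.fst ⁻¹' Metric.closedBall (0 : EuclideanSpace ℝ (Fin 3)) R) < ⊤ := by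
  set c : ℝ := s ^ 2 with hc
  obtain ⟨ξ, hξ⟩ := exists_ne (0 : EuclideanSpace ℝ (Fin 3))
  set w : ℝ → ENNReal := fun P => (Set.Ioi c).indicator
    (fun P => ENNReal.ofReal (1 / Real.sqrt (P - c)) *
      (Set.Iic R).indicator 1 (Real.sqrt (P - c))) P with hw
  set g : ℝ → ENNReal := (Set.Icc 0 ((‖ξ‖ + R) ^ 2)).indicator 1 with hg
  have hwm : Measurable w := by
    refine Measurable.indicator (Measurable.mul (by fun_prop) ?_) measurableSet_Ioi
    exact (measurable_one.indicator measurableSet_Iic).comp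
      (f := fun P : ℝ => Real.sqrt (P - c)) (by fun_prop)
  have hgm : Measurable g := measurable_one.indicator measurableSet_Icc
  have hb := lintegral_norm_sq_norm_sub_sq_le (F := fun P S => w P * g S)
    ((hwm.comp measurable_fst).mul (hgm.comp measurable_snd)) hξ
  have hball : MeasurableSet ((Prod.fst : SpaceTime → _) ⁻¹'
      Metric.closedBall (0 : EuclideanSpace ℝ (Fin 3)) R) :=
    measurable_fst Metric.isClosed_closedBall.measurableSet
  rw [← lintegral_indicator_one hball,
    lintegral_hypMeasure s (measurable_one.indicator hball)]
  refine lt_of_le_of_lt (le_trans (lintegral_mono fun y => ?_) hb) ?_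
  · simp only
    by_cases hy : ‖y‖ ≤ R
    swap
    · rw [Set.indicator_of_notMem (by simpa using hy), mul_zero]; exact zero_le
    by_cases hy' : s < ‖y‖
    swap
    · rw [hypDensity_of_not_lt hy', zero_mul]; exact zero_le
    have h1 : ‖y‖ ^ 2 ∈ Set.Ioi c := pow_lt_pow_left₀ hy' hs.le two_ne_zero
    have h2 : ‖ξ - y‖ ^ 2 ∈ Set.Icc 0 ((‖ξ‖ + R) ^ 2) :=
      ⟨by positivity, pow_le_pow_left₀ (norm_nonneg _) ((norm_sub_le _ _).trans (by linarith)) 2⟩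
    have h3 : Real.sqrt (‖y‖ ^ 2 - c) ∈ Set.Iic R := by
      refine Real.sqrt_le_iff.2 ⟨hR, ?_⟩
      have := pow_le_pow_left₀ (norm_nonneg y) hy 2
      nlinarith [sq_nonneg s]
    rw [hypDensity_of_lt hy', Set.indicator_of_mem (by simpa using hy), hw, hg]
    simp only [Set.indicator_of_mem h1, Set.indicator_of_mem h2, Set.indicator_of_mem h3]
    simp [hc]
  · have h1 : ∫⁻ S, g S = ENNReal.ofReal ((‖ξ‖ + R) ^ 2) := by
      rw [hg, lintegral_indicator_one measurableSet_Icc, Real.volume_Icc, sub_zero]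
    have h2 : ∫⁻ P, w P ≤ 2 * ENNReal.ofReal R := by
      rw [hw, lintegral_indicator measurableSet_Ioi, lintegral_Ioi_sqrt_sub,
        ← lintegral_indicator measurableSet_Ioi]
      gcongr
      have : ∀ u : ℝ, (Set.Ioi (0 : ℝ)).indicator (fun u => (Set.Iic R).indicator
          (1 : ℝ → ENNReal) u) u = (Set.Ioc 0 R).indicator 1 u := by
        intro u
        rw [← Set.Ioi_inter_Iic, ← Set.indicator_indicator]
      simp_rw [this]
      rw [lintegral_indicator_one measurableSet_Ioc, Real.volume_Ioc, sub_zero]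
    simp_rw [lintegral_const_mul _ hgm, h1]
    rw [lintegral_mul_const _ hwm]
    refine ENNReal.mul_lt_top ENNReal.ofReal_lt_top (ENNReal.mul_lt_top ?_ ENNReal.ofReal_lt_top)
    exact h2.trans_lt (ENNReal.mul_lt_top (by simp) ENNReal.ofReal_lt_top)

/-! ### Decomposition into small cubes near the equator. -/

/-- The index of the cube of side `s / 8` containing `y`. -/
noncomputable def cellIndex (s : ℝ) (y : EuclideanSpace ℝ (Fin 3)) : Fin 3 → ℤ :=
  fun i => ⌊8 * y i / s⌋

theorem measurable_cellIndex (s : ℝ) : Measurable (cellIndex s) := by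
  refine measurable_pi_lambda _ fun i => Int.measurable_floor.comp ?_
  fun_prop

/-- The diagonal of a cube of side `s / 8` is `√3 s / 8 ≤ s / 4`. -/
theorem norm_sub_le_of_cellIndex_eq {s : ℝ} (hs : 0 < s) {y w : EuclideanSpace ℝ (Fin 3)}
    (h : cellIndex s y = cellIndex s w) : ‖y - w‖ ≤ s / 4 := by
  have hi : ∀ i, (y i - w i) ^ 2 ≤ (s / 8) ^ 2 := by
    intro i
    have h1 := Int.abs_sub_lt_one_of_floor_eq_floor (congrFun h i)
    rw [← sub_div, ← mul_sub, abs_div, abs_mul, abs_of_pos hs, div_lt_one hs] at h1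
    norm_num at h1
    refine sq_le_sq' ?_ ?_
    · have := neg_abs_le (y i - w i); linarith
    · have := le_abs_self (y i - w i); linarith
  have hsq : ‖y - w‖ ^ 2 ≤ (s / 4) ^ 2 := by
    rw [EuclideanSpace.norm_sq_eq, Fin.sum_univ_three]
    simp only [Real.norm_eq_abs, sq_abs, PiLp.sub_apply]
    have h0 := hi 0
    have h1 := hi 1
    have h2 := hi 2
    nlinarith
  exact (pow_le_pow_iff_left₀ (norm_nonneg _) (by positivity) two_ne_zero).1 hsq

/-- The indices of the cubes of side `s / 8` that meet the ball of radius `2 s`. -/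
@[irreducible] noncomputable def cellIndices : Finset (Fin 3 → ℤ) :=
  Fintype.piFinset fun _ => Finset.Icc (-16) 16

theorem cellIndex_mem {s : ℝ} (hs : 0 < s) {y : EuclideanSpace ℝ (Fin 3)} (hy : ‖y‖ ≤ 2 * s) :
    cellIndex s y ∈ cellIndices := by
  rw [cellIndices, Fintype.mem_piFinset]
  intro i
  rw [Finset.mem_Icc]
  have h1 : |y i| ≤ 2 * s := (PiLp.norm_apply_le y i).trans hy
  have h2 := abs_le.1 h1
  constructor
  · refine Int.le_floor.2 ?_
    rw [le_div_iff₀ hs]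
    push_cast
    linarith
  · refine Int.cast_le (R := ℝ).1 ((Int.floor_le _).trans ?_)
    rw [div_le_iff₀ hs]
    push_cast
    linarith

/-- Over a pair of small cubes either all the sums or all the differences are large. -/
theorem exists_sign_of_cellIndex {s : ℝ} (hs : 0 < s) (c c' : Fin 3 → ℤ) :
    ∃ e : ℝ, (e = 1 ∨ e = -1) ∧ ∀ a b : EuclideanSpace ℝ (Fin 3), s ≤ ‖a‖ → s ≤ ‖b‖ →
      cellIndex s a = c → cellIndex s b = c' → s / 2 ≤ ‖a + e • b‖ := by
  by_contra! hne
  obtain ⟨a, b, ha, hb, hac, hbc, h1⟩ := hne 1 (Or.inl rfl)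
  obtain ⟨a', b', -, -, hac', hbc', h2⟩ := hne (-1) (Or.inr rfl)
  have h3 := norm_sub_le_of_cellIndex_eq hs (hac.trans hac'.symm)
  have h4 := norm_sub_le_of_cellIndex_eq hs (hbc'.trans hbc.symm)
  simp only [one_smul, neg_smul] at h1 h2
  -- Moving within the two cubes costs `s / 4` each, so both `|a + b| < s / 2` and `|a - b| < s`.
  -- The parallelogram law forbids this, since `2|a|² + 2|b|² ≥ 4s²`.
  have h5 : ‖a - b‖ ≤ ‖a' + -b'‖ + ‖a - a'‖ + ‖b' - b‖ := by
    have : a - b = (a' + -b') + (a - a') + (b' - b) := by abel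
    rw [this]
    exact norm_add₃_le
  have h6 : ‖a - b‖ < s := by linarith
  have h7 := parallelogram_law_with_norm ℝ a b
  nlinarith [norm_nonneg (a + b), norm_nonneg (a - b)]

theorem oscTransform_restrict_eq_sum {s : ℝ} (hs : 0 < s)
    {A : Set (EuclideanSpace ℝ (Fin 3))} (hA : MeasurableSet A) (hA2 : ∀ a ∈ A, ‖a‖ ≤ 2 * s)
    {F : SpaceTime → ℂ} (hF : Integrable F ((hypMeasure s).restrict (Prod.fst ⁻¹' A)))
    (z : SpaceTime) :
    oscTransform ((hypMeasure s).restrict (Prod.fst ⁻¹' A)) F z = ∑ c ∈ cellIndices,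
      oscTransform ((hypMeasure s).restrict (Prod.fst ⁻¹' (A ∩ cellIndex s ⁻¹' {c}))) F z := by
  have hU : (Prod.fst ⁻¹' A : Set SpaceTime) =
      ⋃ c ∈ cellIndices, Prod.fst ⁻¹' (A ∩ cellIndex s ⁻¹' {c}) := by
    ext p
    simp only [Set.mem_preimage, Set.mem_iUnion, Set.mem_inter_iff, Set.mem_singleton_iff]
    exact ⟨fun h => ⟨_, cellIndex_mem hs (hA2 _ h), h, rfl⟩, fun ⟨_, _, h, _⟩ => h⟩
  have hcell : ∀ c, MeasurableSet (A ∩ cellIndex s ⁻¹' {c}) := fun c =>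
    hA.inter (measurable_cellIndex s (measurableSet_singleton c))
  simp only [oscTransform]
  conv_lhs => rw [hU]
  refine integral_biUnion_finset _ (fun c _ => measurable_fst (hcell c)) ?_ ?_
  · intro c _ c' _ hcc
    refine Set.disjoint_left.2 fun p hp hp' => hcc ?_
    exact (Set.mem_singleton_iff.1 hp.2).symm.trans (Set.mem_singleton_iff.1 hp'.2)
  · intro c _
    have hFc : IntegrableOn F (Prod.fst ⁻¹' (A ∩ cellIndex s ⁻¹' {c})) (hypMeasure s) :=
      IntegrableOn.mono_set hF (Set.preimage_mono Set.inter_subset_left)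
    exact Integrable.bdd_mul (c := 1) hFc (Continuous.aestronglyMeasurable (by fun_prop))
      (Filter.Eventually.of_forall fun x => (norm_cexp_I_mul_ofReal _).le)

/-- The bilinear bound near the equator. -/
theorem eLpNorm_oscTransform_mul_le_equator {s : ℝ} (hs : 0 < s)
    {A : Set (EuclideanSpace ℝ (Fin 3))} (hA : MeasurableSet A)
    (hA1 : ∀ a ∈ A, s ≤ ‖a‖) (hA2 : ∀ a ∈ A, ‖a‖ ≤ 2 * s) {F G : SpaceTime → ℂ}
    (hF : Integrable F ((hypMeasure s).restrict (Prod.fst ⁻¹' A)))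
    (hG : Integrable G ((hypMeasure s).restrict (Prod.fst ⁻¹' A))) :
    eLpNorm (fun z => oscTransform ((hypMeasure s).restrict (Prod.fst ⁻¹' A)) F z *
        oscTransform ((hypMeasure s).restrict (Prod.fst ⁻¹' A)) G z) 2 volume ≤
      ENNReal.ofReal ((cellIndices.card : ℝ) ^ 2 *
        ((2 * Real.pi) ^ 2 * Real.sqrt (8 * Real.pi))) *
        eLpNorm F 2 ((hypMeasure s).restrict (Prod.fst ⁻¹' A)) *
        eLpNorm G 2 ((hypMeasure s).restrict (Prod.fst ⁻¹' A)) := by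
  set S : (Fin 3 → ℤ) → Set SpaceTime := fun c => Prod.fst ⁻¹' (A ∩ cellIndex s ⁻¹' {c}) with hS
  have hcell : ∀ c, MeasurableSet (A ∩ cellIndex s ⁻¹' {c}) := fun c =>
    hA.inter (measurable_cellIndex s (measurableSet_singleton c))
  have hsub : ∀ c, S c ⊆ Prod.fst ⁻¹' A := fun c => Set.preimage_mono Set.inter_subset_left
  have hFc : ∀ c, Integrable F ((hypMeasure s).restrict (S c)) := fun c =>
    IntegrableOn.mono_set hF (hsub c)
  have hGc : ∀ c, Integrable G ((hypMeasure s).restrict (S c)) := fun c =>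
    IntegrableOn.mono_set hG (hsub c)
  set K := ENNReal.ofReal ((2 * Real.pi) ^ 2 * Real.sqrt (8 * Real.pi)) *
    eLpNorm F 2 ((hypMeasure s).restrict (Prod.fst ⁻¹' A)) *
    eLpNorm G 2 ((hypMeasure s).restrict (Prod.fst ⁻¹' A)) with hK
  have hpair : ∀ c c', eLpNorm (fun z => oscTransform ((hypMeasure s).restrict (S c)) F z *
      oscTransform ((hypMeasure s).restrict (S c')) G z) 2 volume ≤ K := by
    intro c c'
    obtain ⟨e, he, hsum⟩ := exists_sign_of_cellIndex hs c c'
    have h := eLpNorm_oscTransform_mul_le hs he (hcell c) (hcell c') (exists_slice_of_le_norm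
      (e := e) (R := 2 * s) (c := s / 2) (by positivity) (fun a ha => hA2 a ha.1)
      (fun a ha b hb => hsum a b (hA1 a ha.1) (hA1 b hb.1) ha.2 hb.2)) (hFc c) (hGc c')
    -- The density bound `(2π / c) R` with `c = s / 2` and `R = 2s` is free of `s`.
    have hd : 2 * Real.pi / (s / 2) * (2 * s) = 8 * Real.pi := by
      field_simp; ring
    rw [hd] at h
    exact h.trans (mul_le_mul' (mul_le_mul' le_rfl
      (eLpNorm_mono_measure _ (Measure.restrict_mono (hsub c) le_rfl)))
      (eLpNorm_mono_measure _ (Measure.restrict_mono (hsub c') le_rfl)))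
  have hexp : (fun z => oscTransform ((hypMeasure s).restrict (Prod.fst ⁻¹' A)) F z *
      oscTransform ((hypMeasure s).restrict (Prod.fst ⁻¹' A)) G z) =
      ∑ x ∈ cellIndices ×ˢ cellIndices, fun z =>
        oscTransform ((hypMeasure s).restrict (S x.1)) F z *
          oscTransform ((hypMeasure s).restrict (S x.2)) G z := by
    funext z
    rw [oscTransform_restrict_eq_sum hs hA hA2 hF, oscTransform_restrict_eq_sum hs hA hA2 hG,
      Finset.sum_mul_sum, ← Finset.sum_product', Finset.sum_apply]
  rw [hexp]
  refine (eLpNorm_sum_le (fun x _ => ?_) (by norm_num)).trans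
    ((Finset.sum_le_card_nsmul _ _ K fun x _ => hpair x.1 x.2).trans (le_of_eq ?_))
  · exact ((continuous_oscTransform (hFc x.1)).mul
      (continuous_oscTransform (hGc x.2))).aestronglyMeasurable
  · rw [Finset.card_product, nsmul_eq_mul, hK, ENNReal.ofReal_mul (by positivity), ← mul_assoc,
      ← mul_assoc]
    congr 2
    rw [ENNReal.ofReal_mul (by positivity), ENNReal.ofReal_pow (Nat.cast_nonneg _),
      ENNReal.ofReal_natCast, Nat.cast_mul, ← pow_two, ENNReal.ofReal_mul (by positivity)]

/-! ### Dyadic annuli: the three regimes and the final constant. -/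

/-- The dyadic annulus `2^k s ≤ |y| ≤ 2^(k+1) s`. -/
def dyadicAnnulus (s : ℝ) (k : ℕ) : Set (EuclideanSpace ℝ (Fin 3)) :=
  {y | (2 : ℝ) ^ k * s ≤ ‖y‖ ∧ ‖y‖ ≤ (2 : ℝ) ^ (k + 1) * s}

theorem measurableSet_dyadicAnnulus (s : ℝ) (k : ℕ) : MeasurableSet (dyadicAnnulus s k) :=
  (measurableSet_le measurable_const measurable_norm).inter
    (measurableSet_le measurable_norm measurable_const)

/-- The constant of the bilinear extension estimate. -/
noncomputable def hypConstant : ℝ :=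
  2 * ((cellIndices.card : ℝ) ^ 2 * ((2 * Real.pi) ^ 2 * Real.sqrt (8 * Real.pi)))

/-- For annuli that are equal or adjacent the decay factor is at least `2^{-1/4} ≥ 1/2`, which the
factor `2` in `hypConstant` absorbs. -/
theorem le_hypConstant_mul {x : ℝ} (hx : -(1 / 4) ≤ x) :
    (cellIndices.card : ℝ) ^ 2 * ((2 * Real.pi) ^ 2 * Real.sqrt (8 * Real.pi)) ≤
      hypConstant * (2 : ℝ) ^ x := by
  have h1 : (1 / 2 : ℝ) ≤ (2 : ℝ) ^ x := by
    calc (1 / 2 : ℝ) = (2 : ℝ) ^ (-1 : ℝ) := by rw [Real.rpow_neg_one]; norm_num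
      _ ≤ _ := Real.rpow_le_rpow_of_exponent_le (by norm_num) (by linarith)
  rw [hypConstant]
  have h2 : 0 ≤ (cellIndices.card : ℝ) ^ 2 * ((2 * Real.pi) ^ 2 * Real.sqrt (8 * Real.pi)) := by
    positivity
  nlinarith

theorem one_le_card_cellIndices : (1 : ℝ) ≤ (cellIndices.card : ℝ) ^ 2 := by
  have h : 1 ≤ cellIndices.card :=
    Finset.card_pos.2 ⟨_, cellIndex_mem one_pos (y := 0) (by simp)⟩
  exact one_le_pow₀ (by exact_mod_cast h)

theorem base_le_cellIndices :
    (2 * Real.pi) ^ 2 * Real.sqrt (8 * Real.pi) ≤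
      (cellIndices.card : ℝ) ^ 2 * ((2 * Real.pi) ^ 2 * Real.sqrt (8 * Real.pi)) :=
  le_mul_of_one_le_left (by positivity) one_le_card_cellIndices

theorem eLpNorm_oscTransform_mul_le_of_le {s : ℝ} (hs : 0 < s) {k k' : ℕ} (hkk : k ≤ k')
    {F G : SpaceTime → ℂ}
    (hF : Integrable F ((hypMeasure s).restrict (Prod.fst ⁻¹' dyadicAnnulus s k)))
    (hG : Integrable G ((hypMeasure s).restrict (Prod.fst ⁻¹' dyadicAnnulus s k'))) :
    eLpNorm (fun z => oscTransform ((hypMeasure s).restrict (Prod.fst ⁻¹' dyadicAnnulus s k)) F z *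
        oscTransform ((hypMeasure s).restrict (Prod.fst ⁻¹' dyadicAnnulus s k')) G z) 2 volume ≤
      ENNReal.ofReal (hypConstant * (2 : ℝ) ^ (-(1 / 4 : ℝ) * |(k : ℝ) - (k' : ℝ)|)) *
        eLpNorm F 2 ((hypMeasure s).restrict (Prod.fst ⁻¹' dyadicAnnulus s k)) *
        eLpNorm G 2 ((hypMeasure s).restrict (Prod.fst ⁻¹' dyadicAnnulus s k')) := by
  have habs : |(k : ℝ) - (k' : ℝ)| = (k' : ℝ) - k := by
    rw [abs_sub_comm, abs_of_nonneg (sub_nonneg.2 (by exact_mod_cast hkk))]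
  have hmk := measurableSet_dyadicAnnulus s k
  have hmk' := measurableSet_dyadicAnnulus s k'
  rw [habs]
  suffices h : ∃ d : ℝ, d ≤ hypConstant * (2 : ℝ) ^ (-(1 / 4 : ℝ) * ((k' : ℝ) - k)) ∧
      eLpNorm (fun z =>
        oscTransform ((hypMeasure s).restrict (Prod.fst ⁻¹' dyadicAnnulus s k)) F z *
        oscTransform ((hypMeasure s).restrict (Prod.fst ⁻¹' dyadicAnnulus s k')) G z) 2 volume ≤
      ENNReal.ofReal d *
        eLpNorm F 2 ((hypMeasure s).restrict (Prod.fst ⁻¹' dyadicAnnulus s k)) *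
        eLpNorm G 2 ((hypMeasure s).restrict (Prod.fst ⁻¹' dyadicAnnulus s k')) by
    obtain ⟨d, hd, h⟩ := h
    exact h.trans (mul_le_mul_left (mul_le_mul_left (ENNReal.ofReal_le_ofReal hd) _) _)
  rcases Nat.lt_or_ge (k + 1) k' with hfar | hnear
  -- Here `k' = k + n + 2`, so `|b|` is at least twice `2^{k+n+1} s` while `|a|` is at most that
  -- quantity.
  · obtain ⟨n, rfl⟩ := Nat.exists_eq_add_of_lt hfar
    have hsum : ∀ a ∈ dyadicAnnulus s k, ∀ b ∈ dyadicAnnulus s (k + 1 + n + 1),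
        (2 : ℝ) ^ (k + n + 1) * s ≤ ‖a + (1 : ℝ) • b‖ := by
      intro a ha b hb
      have h1 := norm_sub_norm_le b (-a)
      rw [norm_neg, sub_neg_eq_add, add_comm b a] at h1
      rw [one_smul]
      have h2 : (2 : ℝ) ^ (k + 1) * s ≤ (2 : ℝ) ^ (k + n + 1) * s := by
        gcongr
        · norm_num
        · omega
      have h3 : (2 : ℝ) ^ (k + 1 + n + 1) * s = 2 * ((2 : ℝ) ^ (k + n + 1) * s) := by ring
      have h4 := hb.1
      have h5 := ha.2
      linarith
    refine ⟨_, ?_, eLpNorm_oscTransform_mul_le hs (Or.inl rfl) hmk hmk' (exists_slice_of_le_norm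
      (R := (2 : ℝ) ^ (k + 1) * s) (by positivity) (fun a ha => ha.2) hsum) hF hG⟩
    have hd : 2 * Real.pi / ((2 : ℝ) ^ (k + n + 1) * s) * ((2 : ℝ) ^ (k + 1) * s) =
        8 * Real.pi * (2 : ℝ) ^ (-((n : ℝ) + 2)) := by
      rw [Real.rpow_neg (by norm_num), Real.rpow_add (by norm_num), Real.rpow_natCast]
      field_simp
      norm_num
      ring
    rw [hd, Real.sqrt_mul (by positivity), Real.sqrt_eq_rpow ((2 : ℝ) ^ (-((n : ℝ) + 2))),
      ← Real.rpow_mul (by norm_num), ← mul_assoc]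
    -- The square root of the density decays like `2^{-(k'-k)/2}`, stronger than the exponent `1/4`
    -- asked for.
    have hexp : (2 : ℝ) ^ (-((n : ℝ) + 2) * (1 / 2)) ≤
        (2 : ℝ) ^ (-(1 / 4 : ℝ) * (((k + 1 + n + 1 : ℕ) : ℝ) - k)) := by
      refine Real.rpow_le_rpow_of_exponent_le (by norm_num) ?_
      push_cast
      have : (0 : ℝ) ≤ n := Nat.cast_nonneg n
      linarith
    refine mul_le_mul (base_le_cellIndices.trans ?_) hexp (by positivity) ?_
    · rw [hypConstant]
      exact le_mul_of_one_le_left (by positivity) (by norm_num)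
    · rw [hypConstant]; positivity
  · have hx : -(1 / 4 : ℝ) ≤ -(1 / 4 : ℝ) * ((k' : ℝ) - k) := by
      have : (k' : ℝ) ≤ k + 1 := by exact_mod_cast hnear
      linarith
    -- The larger annulus meets the equator only if `k' = 0`, which forces `k = 0`; otherwise it
    -- lies in `|y| ≥ 2s`.
    rcases Nat.eq_zero_or_pos k' with rfl | hpos
    · obtain rfl : k = 0 := by omega
      refine ⟨_, le_hypConstant_mul hx, eLpNorm_oscTransform_mul_le_equator hs hmk
        (fun a ha => ?_) (fun a ha => ?_) hF hG⟩
      · simpa using ha.1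
      · simpa using ha.2
    · refine ⟨_, base_le_cellIndices.trans (le_hypConstant_mul hx),
        eLpNorm_oscTransform_mul_le hs (Or.inl rfl) hmk hmk'
          (exists_slice_of_two_mul_le_norm hs fun b hb => ?_) hF hG⟩
      refine le_trans ?_ hb.1
      gcongr
      exact le_self_pow₀ (by norm_num) hpos.ne'

/-! ### Integrability, restriction to annuli and conclusion. -/

theorem integrable_hypMeasure_of_annulus {s : ℝ} (hs : 0 < s) {k : ℕ} {f : SpaceTime → ℂ}
    (hf : MemLp f 2 (hypMeasure s))
    (hsupp : ∀ᵐ p ∂(hypMeasure s), f p ≠ 0 → p.1 ∈ dyadicAnnulus s k) :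
    Integrable f (hypMeasure s) := by
  set S : Set SpaceTime := Prod.fst ⁻¹' dyadicAnnulus s k with hS
  have hfin : IsFiniteMeasure ((hypMeasure s).restrict S) := by
    refine ⟨?_⟩
    rw [Measure.restrict_apply_univ]
    refine lt_of_le_of_lt (measure_mono fun p hp => ?_) (hypMeasure_preimage_closedBall_lt_top hs
      (R := (2 : ℝ) ^ (k + 1) * s) (by positivity))
    exact mem_closedBall_zero_iff.2 hp.2
  have hon : IntegrableOn f S (hypMeasure s) := (hf.restrict S).integrable (by norm_num)
  refine hon.integrable_of_ae_notMem_eq_zero ?_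
  filter_upwards [hsupp] with p hp hpS
  by_contra hne
  exact hpS (hp hne)

theorem hypExtension_eq_oscTransform_restrict {s : ℝ} {k : ℕ} {f : SpaceTime → ℂ}
    (hsupp : ∀ᵐ p ∂(hypMeasure s), f p ≠ 0 → p.1 ∈ dyadicAnnulus s k) (z : SpaceTime) :
    hypExtension s f z =
      oscTransform ((hypMeasure s).restrict (Prod.fst ⁻¹' dyadicAnnulus s k)) f z := by
  refine (setIntegral_eq_integral_of_ae_compl_eq_zero ?_).symm
  filter_upwards [hsupp] with p hp hpS
  have : f p = 0 := by
    by_contra hne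
    exact hpS (hp hne)
  rw [this, mul_zero]

theorem mainTheorem7 :
    ∃ C : NNReal, ∀ (s : ℝ), 0 < s → ∀ (k k' : ℕ) (f g : SpaceTime → ℂ),
      MemLp f 2 (hypMeasure s) → MemLp g 2 (hypMeasure s) →
      (∀ᵐ p ∂(hypMeasure s), f p ≠ 0 → (2 : ℝ) ^ k * s ≤ ‖p.1‖ ∧ ‖p.1‖ ≤ (2 : ℝ) ^ (k + 1) * s) →
      (∀ᵐ p ∂(hypMeasure s),
        g p ≠ 0 → (2 : ℝ) ^ k' * s ≤ ‖p.1‖ ∧ ‖p.1‖ ≤ (2 : ℝ) ^ (k' + 1) * s) →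
      Integrable f (hypMeasure s) ∧ Integrable g (hypMeasure s) ∧
      MemLp (fun z => hypExtension s f z * hypExtension s g z) 2 volume ∧
      eLpNorm (fun z => hypExtension s f z * hypExtension s g z) 2 volume ≤
        (C : ENNReal) * ENNReal.ofReal ((2 : ℝ) ^ (-(1 / 4 : ℝ) * |(k : ℝ) - (k' : ℝ)|)) *
          eLpNorm f 2 (hypMeasure s) * eLpNorm g 2 (hypMeasure s) := by
  refine ⟨hypConstant.toNNReal, fun s hs k k' f g hf hg hfs hgs => ?_⟩
  have hfi := integrable_hypMeasure_of_annulus hs hf hfs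
  have hgi := integrable_hypMeasure_of_annulus hs hg hgs
  have hbound : eLpNorm (fun z => hypExtension s f z * hypExtension s g z) 2 volume ≤
      (hypConstant.toNNReal : ENNReal) *
        ENNReal.ofReal ((2 : ℝ) ^ (-(1 / 4 : ℝ) * |(k : ℝ) - (k' : ℝ)|)) *
          eLpNorm f 2 (hypMeasure s) * eLpNorm g 2 (hypMeasure s) := by
    have hC : 0 ≤ hypConstant := by rw [hypConstant]; positivity
    simp only [hypExtension_eq_oscTransform_restrict hfs, hypExtension_eq_oscTransform_restrict hgs]
    rw [show (hypConstant.toNNReal : ENNReal) = ENNReal.ofReal hypConstant from rfl,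
      ← ENNReal.ofReal_mul hC]
    refine le_trans ?_ (mul_le_mul' (mul_le_mul' le_rfl (eLpNorm_restrict_le f 2 _
      (Prod.fst ⁻¹' dyadicAnnulus s k))) (eLpNorm_restrict_le g 2 _
      (Prod.fst ⁻¹' dyadicAnnulus s k')))
    -- The estimate is symmetric in the two functions, so the case `k' ≤ k` follows by exchanging
    -- them.
    rcases le_total k k' with h | h
    · exact eLpNorm_oscTransform_mul_le_of_le hs h hfi.restrict hgi.restrict
    · have := eLpNorm_oscTransform_mul_le_of_le hs h hgi.restrict hfi.restrict
      rw [abs_sub_comm, mul_right_comm]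
      simpa only [mul_comm (oscTransform _ g _)] using this
  refine ⟨hfi, hgi, ⟨?_, hbound.trans_lt ?_⟩, hbound⟩
  · exact ((continuous_oscTransform hfi).mul (continuous_oscTransform hgi)).aestronglyMeasurable
  · exact ENNReal.mul_lt_top (ENNReal.mul_lt_top (ENNReal.mul_lt_top ENNReal.coe_lt_top
      ENNReal.ofReal_lt_top) hf.eLpNorm_lt_top) hg.eLpNorm_lt_top
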